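/- Let $X$ be a locally compact Hausdorff space and let $\mathfrak M$ be the space of (signed, real-valued) Radon measures on $X$, with the vague topology (pointwise convergence on continuous functions with compact support). Let $\kappa:X\times X\to(-\infty,\infty]$ be a kernel, i.e. a lower semicontinuous function, nonnegative unless $X$ is compact. For $\nu,\nu_1\in\mathfrak M$ put $\kappa(x,\nu)=\int\kappa(x,y)\,d\nu(y)$ and $\kappa(\nu,\nu_1)=\int\kappa\,d(\nu\otimes\nu_1)$ whenever these are well defined, let $\mathcal E$ be the set of $\nu\in\mathfrak M$ of finite energy $\kappa(\nu,\nu)$, and let $\mathcal E^+$ be the set of nonnegative $\nu\in\mathcal E$. Assume that $\kappa$ is strictly positive definite: it is symmetric, $\kappa(\nu,\nu)\ge 0$ for all $\nu\in\mathfrak M$ for which the energy is defined, and $\kappa(\nu,\nu)=0$ with $\nu\in\mathcal E$ only for $\nu=0$. Assume also that $\kappa$ is consistent: whenever a net in $\mathcal E^+$ with bounded energies converges vaguely to a measure $\nu_0$, then $\nu_0\in\mathcal E^+$ and the net converges to $\nu_0$ weakly in $\mathcal E$, i.e. $\kappa(\nu,\omega)\to\kappa(\nu_0,\omega)$ along the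 net for every $\omega\in\mathcal E$. The interior capacity of a set $E\subset X$ is $C(E)=1/\inf\kappa(\nu,\nu)$, the infimum being over the nonnegative Radon measures $\nu$ with $\nu(X)=1$ and compact support contained in $E$ ($\inf\varnothing=\infty$, $1/0=\infty$, $1/\infty=0$); a property holds n.e. (nearly everywhere) in $E$ if the set of points of $E$ where it fails has interior capacity zero (points where an expression in it is undefined count as failures). Let $\mathbf A=(A_i)_{i\in I}$ be a condenser: $I=I^+\cup I^-$ is a countable (finite or infinite) index set, $I^+\cap I^-=\varnothing$, the $A_i\subset X$ are nonempty and closed, every compact subset of $X$ meets only finitely many $A_i$, and $A_i\cap A_j=\varnothing$ for $i\in I^+$, $j\in I^-$. Put $A^\pm=\bigcup_{i\in I^\pm}A_i$, and $\alpha_i=\pm1$ for $i\in I^\pm$. Let $a_i>0$ be real numbers and $g_i:X\to(0,\infty)$ continuous functions, $i\in I$. The capacity of the condenser is $$\mathrm{cap}(\mathbf A,\mathbf a,\mathbf g)=\frac1{\inf\,\kappa(R\mu,R\mu)},\qquad R\mu=\sum_{i\in I}\alpha_i\mu^i,$$ the infimum being over all families $\mu=(\mu^i)_{i\in I}$ of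 nonnegative Radon measures $\mu^i$ supported by $A_i$ with $\int g_i\,d\mu^i=a_i$ for all $i\in I$ and $R\mu\in\mathcal E$ (same conventions as above). Assume that either $I^-=\varnothing$, or both $$\sum_{i\in I}\frac{a_i}{\inf_{A_i}g_i}<\infty\qquad\text{and}\qquad \sup_{x\in A^+,\,y\in A^-}\kappa(x,y)<\infty.$$ Assume further that for every $i\in I$ either $\sup_{A_i}g_i<\infty$, or there are $r_i\in(1,\infty)$ and $\omega_i\in\mathcal E$ with $g_i(x)^{r_i}\le\kappa(x,\omega_i)$ n.e. in $A_i$. If $C(A_j)<\infty$ for some $j\in I$, then $\mathrm{cap}(\mathbf A,\mathbf a,\mathbf g)<\infty$. -/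

import Mathlib

open MeasureTheory Set Filter Topology
open scoped ENNReal

namespace CondenserTheory

noncomputable section

/-! ## Integrals of functions with values in the extended reals -/

section Integrals

variable {X : Type*} [MeasurableSpace X]

/-- The integral `∫ f dν` of an extended real valued function against a nonnegative measure: the
integral of the positive part minus the integral of the negative part. It is only used for
functions that are bounded below by `0`, or bounded below on a compact space and integrated against
a finite measure; the second term is then finite and the result lies in `(-∞, ∞]`. -/
def eintegral (ν : Measure X) (f : X → EReal) : EReal :=
  ((∫⁻ x, (f x).toENNReal ∂ν : ℝ≥0∞) : EReal) - ((∫⁻ x, (-f x).toENNReal ∂ν : ℝ≥0∞) : EReal)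

/-- The potential `κ(x, ν) = ∫ κ(x, y) dν(y)` of a nonnegative measure. -/
def potential (κ : X → X → EReal) (ν : Measure X) (x : X) : EReal :=
  eintegral ν (κ x)

/-- The mutual energy `κ(ν, ν₁) = ∫ κ(x, y) d(ν ⊗ ν₁)(x, y)` of two nonnegative measures, as an
iterated integral. (For a lower semicontinuous kernel and Radon measures this is the integral
against the Radon product measure; the iterated form avoids the product `σ`-algebra, which need not
contain all open subsets of `X × X`.) -/
def mutualEnergy (κ : X → X → EReal) (ν ν₁ : Measure X) : EReal :=
  eintegral ν (potential κ ν₁)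

end Integrals

/-! ## Kernels, signed Radon measures, energy -/

section Kernels

variable {X : Type*} [TopologicalSpace X]

/-- A kernel: a lower semicontinuous function `X × X → (-∞, ∞]` which is nonnegative unless `X` is
compact. -/
structure IsKernel (κ : X → X → EReal) : Prop where
  lsc : LowerSemicontinuous fun p : X × X => κ p.1 p.2
  ne_bot : ∀ x y, κ x y ≠ ⊥
  nonneg : ¬ CompactSpace X → ∀ x y, 0 ≤ κ x y

variable [MeasurableSpace X] [BorelSpace X]

/-- A real-valued (signed) Radon measure on `X`, written as a difference `ν = pos - neg` of two
nonnegative Radon measures (both may have infinite mass). The presentation need not be the Jordan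
decomposition; two presentations `(p, n)`, `(p', n')` give the same measure when
`p + n' = p' + n`. -/
structure SignedRadon (X : Type*) [TopologicalSpace X] [MeasurableSpace X] [BorelSpace X] where
  pos : Measure X
  neg : Measure X
  regular_pos : pos.Regular
  regular_neg : neg.Regular

namespace SignedRadon

variable (κ : X → X → EReal) (ν : SignedRadon X)

/-- `ν = 0` as a signed measure. -/
def IsZero : Prop := ν.pos = ν.neg

/-- The contribution to the energy of the positive part
`pos ⊗ pos + neg ⊗ neg` of the product measure `ν ⊗ ν`. -/
def energyPlus : EReal := mutualEnergy κ ν.pos ν.pos + mutualEnergy κ ν.neg ν.neg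

/-- The contribution to the energy of the negative part
`pos ⊗ neg + neg ⊗ pos` of the product measure `ν ⊗ ν`. -/
def energyMinus : EReal := mutualEnergy κ ν.pos ν.neg + mutualEnergy κ ν.neg ν.pos

/-- The energy `κ(ν, ν)` is well defined, i.e. not of the form `∞ - ∞`. -/
def EnergyDefined : Prop := ¬ (ν.energyPlus κ = ⊤ ∧ ν.energyMinus κ = ⊤)

/-- The energy `κ(ν, ν)`. -/
def energy : EReal := ν.energyPlus κ - ν.energyMinus κ

/-- `ν ∈ 𝓔`: the energy is well defined and finite. -/
def FiniteEnergy : Prop := ν.EnergyDefined κ ∧ ⊥ < ν.energy κ ∧ ν.energy κ < ⊤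

/-- The potential `κ(x, ν)` is well defined, i.e. not of the form `∞ - ∞`. -/
def PotentialDefined (x : X) : Prop := ¬ (potential κ ν.pos x = ⊤ ∧ potential κ ν.neg x = ⊤)

/-- The potential `κ(x, ν)`. -/
def pot (x : X) : EReal := potential κ ν.pos x - potential κ ν.neg x

end SignedRadon

/-- Positive definite kernels: symmetric, and the energy of every signed Radon measure is
nonnegative whenever it is well defined. -/
def PositiveDefinite (κ : X → X → EReal) : Prop :=
  (∀ x y, κ x y = κ y x) ∧ ∀ ν : SignedRadon X, ν.EnergyDefined κ → 0 ≤ ν.energy κ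

/-- Strictly positive definite kernels: the energy seminorm on `𝓔` is a norm. -/
def StrictlyPositiveDefinite (κ : X → X → EReal) : Prop :=
  PositiveDefinite κ ∧ ∀ ν : SignedRadon X, ν.FiniteEnergy κ → ν.energy κ = 0 → ν.IsZero

/-- `ν ∈ 𝓔⁺`: nonnegative Radon measures of finite energy. -/
def FiniteEnergyPlus (κ : X → X → EReal) (ν : Measure X) : Prop :=
  ν.Regular ∧ ⊥ < mutualEnergy κ ν ν ∧ mutualEnergy κ ν ν < ⊤

/-- Vague convergence along a filter: convergence of integrals of all continuous functions with
compact support. -/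
def VagueTendsto (F : Filter (Measure X)) (ν₀ : Measure X) : Prop :=
  ∀ φ : X → ℝ, Continuous φ → HasCompactSupport φ →
    Tendsto (fun ν : Measure X => ∫ x, φ x ∂ν) F (𝓝 (∫ x, φ x ∂ν₀))

/-- Consistent kernels: every strongly bounded and vaguely convergent net (here: filter) in `𝓔⁺`
converges weakly to its vague limit, i.e. the limit lies in `𝓔⁺` and `κ(ν, ω) → κ(ν₀, ω)` for every
signed `ω ∈ 𝓔`. -/
def Consistent (κ : X → X → EReal) : Prop :=
  ∀ (F : Filter (Measure X)) (ν₀ : Measure X) (M : ℝ), F.NeBot → ν₀.Regular →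
    (∀ᶠ ν in F, FiniteEnergyPlus κ ν ∧ mutualEnergy κ ν ν ≤ (M : EReal)) →
    VagueTendsto F ν₀ →
    FiniteEnergyPlus κ ν₀ ∧
      ∀ ω : SignedRadon X, ω.FiniteEnergy κ →
        Tendsto (fun ν : Measure X => mutualEnergy κ ν ω.pos - mutualEnergy κ ν ω.neg) F
          (𝓝 (mutualEnergy κ ν₀ ω.pos - mutualEnergy κ ν₀ ω.neg))

/-- The interior capacity `C(E)` of an arbitrary set: `1 / w`, where `w` is the infimum of the
energies of the nonnegative Radon measures of unit mass with compact support contained in `E`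
(`1 / 0 = ∞`, `1 / ∞ = 0`). -/
def interiorCapacity (κ : X → X → EReal) (E : Set X) : ℝ≥0∞ :=
  (⨅ (ν : Measure X) (_ : ν.Regular ∧ ν univ = 1 ∧ ∃ K : Set X, IsCompact K ∧ K ⊆ E ∧ ν Kᶜ = 0),
    (mutualEnergy κ ν ν).toENNReal)⁻¹

/-- `P` holds nearly everywhere in `E`: the set of exceptional points of `E` has interior capacity
zero. -/
def NearlyEverywhere (κ : X → X → EReal) (E : Set X) (P : X → Prop) : Prop :=
  interiorCapacity κ {x ∈ E | ¬ P x} = 0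

end Kernels

/-! ## Condensers -/

/-- A condenser with plates indexed by `ι`: nonempty closed sets, each compact set meeting only
finitely many of them, with a sign prescribed to each index (`+` on `plus`, `-` off `plus`) such
that oppositely signed plates are disjoint. -/
structure Condenser (X : Type*) [TopologicalSpace X] (ι : Type*) where
  plus : Set ι
  plate : ι → Set X
  nonempty : ∀ i, (plate i).Nonempty
  isClosed : ∀ i, IsClosed (plate i)
  finite_inter : ∀ K : Set X, IsCompact K → {i | (plate i ∩ K).Nonempty}.Finite
  disjoint : ∀ i ∈ plus, ∀ j ∉ plus, Disjoint (plate i) (plate j)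

section Regularity

variable {X : Type*} [TopologicalSpace X] [T2Space X] [LocallyCompactSpace X] [MeasurableSpace X]
  [BorelSpace X] {ι : Type*}

/-- A countable sum of Radon measures carried by a locally finite family of closed sets is again a
Radon measure. -/
theorem regular_sum [Countable ι] (A : ι → Set X) (hA : ∀ i, IsClosed (A i))
    (hfin : ∀ K : Set X, IsCompact K → {i | (A i ∩ K).Nonempty}.Finite)
    (μ : ι → Measure X) (hμ : ∀ i, (μ i).Regular) (hsupp : ∀ i, μ i (A i)ᶜ = 0) :
    (Measure.sum μ).Regular := by
  have := hμ
  have hlf : LocallyFinite A := by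
    intro x
    obtain ⟨K, hK, hxK⟩ := exists_compact_mem_nhds x
    exact ⟨K, hxK, hfin K hK⟩
  refine { lt_top_of_isCompact := ?_, outerRegular := ?_, innerRegular := ?_ }
  · intro K hK
    rw [Measure.sum_apply _ hK.measurableSet,
      tsum_eq_sum (s := (hfin K hK).toFinset) (fun i hi => ?_)]
    · exact ENNReal.sum_lt_top.2 fun i _ => hK.measure_lt_top
    · have hi' : A i ∩ K = ∅ := by simpa [Set.not_nonempty_iff_eq_empty] using hi
      refine measure_mono_null (t := (A i)ᶜ) ?_ (hsupp i)
      intro x hx hxA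
      have hx' : x ∈ A i ∩ K := ⟨hxA, hx⟩
      rw [hi'] at hx'
      exact hx'
  · intro S hS r hr
    rw [Measure.sum_apply _ hS] at hr
    obtain ⟨δ, δpos, hδ⟩ := ENNReal.exists_pos_sum_of_countable' (tsub_pos_iff_lt.2 hr).ne' ι
    have hne : ∀ i, μ i S ≠ ∞ := fun i => ((ENNReal.le_tsum i).trans_lt hr).ne_top
    choose U hSU hU hUlt using fun i => S.exists_isOpen_lt_add (hne i) (δpos i).ne'
    have hcl : IsClosed (⋃ i, A i \ U i) :=
      (hlf.subset fun i => sdiff_subset).isClosed_iUnion fun i => (hA i).sdiff (hU i)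
    refine ⟨(⋃ i, A i \ U i)ᶜ, ?_, hcl.isOpen_compl, ?_⟩
    · intro x hx hx'
      obtain ⟨i, hi⟩ := mem_iUnion.1 hx'
      exact hi.2 (hSU i hx)
    · rw [Measure.sum_apply _ hcl.isOpen_compl.measurableSet]
      have key : ∀ i, μ i (⋃ i, A i \ U i)ᶜ ≤ μ i S + δ i := by
        intro i
        refine le_trans ?_ (hUlt i).le
        have hsub : (⋃ i, A i \ U i)ᶜ ⊆ U i ∪ (A i)ᶜ := by
          intro x hx
          by_contra hcon
          rw [mem_union, not_or, notMem_compl_iff] at hcon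
          exact hx (mem_iUnion.2 ⟨i, hcon.2, hcon.1⟩)
        calc μ i (⋃ i, A i \ U i)ᶜ ≤ μ i (U i ∪ (A i)ᶜ) := measure_mono hsub
          _ ≤ μ i (U i) + μ i (A i)ᶜ := measure_union_le _ _
          _ = μ i (U i) := by rw [hsupp i, add_zero]
      calc ∑' i, μ i (⋃ i, A i \ U i)ᶜ ≤ ∑' i, (μ i S + δ i) := ENNReal.tsum_le_tsum key
        _ = ∑' i, μ i S + ∑' i, δ i := ENNReal.tsum_add
        _ < r := by
          rw [add_comm]
          exact lt_tsub_iff_right.1 hδ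
  · intro U hU r hr
    rw [Measure.sum_apply _ hU.measurableSet, ENNReal.tsum_eq_iSup_sum] at hr
    obtain ⟨s, hs⟩ := lt_iSup_iff.1 hr
    have hind : ∀ (t : Finset ι) (r : ℝ≥0∞), r < ∑ i ∈ t, μ i U →
        ∃ K ⊆ U, IsCompact K ∧ r < ∑ i ∈ t, μ i K := by
      intro t r hr
      have hsup : ∑ i ∈ t, μ i U = ⨆ K : {K : Set X // K ⊆ U ∧ IsCompact K},
          ∑ i ∈ t, μ i K.1 := by
        rw [← ENNReal.finsetSum_iSup]
        · refine Finset.sum_congr rfl fun i _ => ?_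
          rw [hU.measure_eq_iSup_isCompact]
          simp only [iSup_subtype, iSup_and]
        · intro K L
          exact ⟨⟨K.1 ∪ L.1, union_subset K.2.1 L.2.1, K.2.2.union L.2.2⟩, fun i =>
            ⟨measure_mono subset_union_left, measure_mono subset_union_right⟩⟩
      rw [hsup] at hr
      obtain ⟨K, hK⟩ := lt_iSup_iff.1 hr
      exact ⟨K.1, K.2.1, K.2.2, hK⟩
    obtain ⟨K, hKU, hK, hrK⟩ := hind s r hs
    refine ⟨K, hKU, hK, hrK.trans_le ?_⟩
    rw [Measure.sum_apply _ hK.measurableSet]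
    exact ENNReal.sum_le_tsum s

end Regularity

namespace Condenser

variable {X : Type*} [TopologicalSpace X] {ι : Type*}

/-- The union `A⁺` of the positive plates. -/
def plusSet (A : Condenser X ι) : Set X := ⋃ i ∈ A.plus, A.plate i

/-- The union `A⁻` of the negative plates. -/
def minusSet (A : Condenser X ι) : Set X := ⋃ i ∈ A.plusᶜ, A.plate i

variable [MeasurableSpace X] [BorelSpace X]

/-- The class `𝔐(A)`: a measure associated with the condenser, given by its coordinates, nonnegative
Radon measures `μ i` carried by the plates. -/
structure AssocMeasure (A : Condenser X ι) where
  coord : ι → Measure X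
  regular : ∀ i, (coord i).Regular
  supported : ∀ i, coord i (A.plate i)ᶜ = 0

/-- The signed Radon measure `Rμ = ∑ i, α i • μ i`, with positive part the sum over the positive
plates and negative part the sum over the negative plates. -/
def AssocMeasure.R [T2Space X] [LocallyCompactSpace X] [Countable ι] {A : Condenser X ι}
    (μ : A.AssocMeasure) : SignedRadon X where
  pos := Measure.sum fun i : A.plus => μ.coord i
  neg := Measure.sum fun i : (A.plusᶜ : Set ι) => μ.coord i
  regular_pos := regular_sum (fun i : A.plus => A.plate i) (fun i => A.isClosed i)
    (fun K hK => Set.Finite.preimage (s := {i | (A.plate i ∩ K).Nonempty})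
      Subtype.val_injective.injOn (A.finite_inter K hK)) _
    (fun i => μ.regular i) (fun i => μ.supported i)
  regular_neg := regular_sum (fun i : (A.plusᶜ : Set ι) => A.plate i) (fun i => A.isClosed i)
    (fun K hK => Set.Finite.preimage (s := {i | (A.plate i ∩ K).Nonempty})
      Subtype.val_injective.injOn (A.finite_inter K hK)) _
    (fun i => μ.regular i) (fun i => μ.supported i)

/-- The class `𝓔(A, a, g)`: associated measures of finite energy with `∫ g i dμ i = a i` for
all `i`. -/
def Admissible [T2Space X] [LocallyCompactSpace X] [Countable ι] (κ : X → X → EReal)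
    (A : Condenser X ι) (a : ι → ℝ) (g : ι → X → ℝ) : Set A.AssocMeasure :=
  {μ | μ.R.FiniteEnergy κ ∧
    ∀ i, ∫⁻ x, ENNReal.ofReal (g i x) ∂(μ.coord i) = ENNReal.ofReal (a i)}

/-- The interior capacity of the condenser, `cap(A, a, g) = 1 / inf κ(μ, μ)`, the infimum being
over `𝓔(A, a, g)` (`inf ∅ = ∞`, `1 / 0 = ∞`, `1 / ∞ = 0`). -/
def capacity [T2Space X] [LocallyCompactSpace X] [Countable ι] (κ : X → X → EReal)
    (A : Condenser X ι) (a : ι → ℝ) (g : ι → X → ℝ) : ℝ≥0∞ :=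
  (⨅ μ ∈ Admissible κ A a g, (μ.R.energy κ).toENNReal)⁻¹

/-- The growth condition on the `i`-th plate: `g ^ r ≤ κ(·, ω)` nearly everywhere in the plate, for
some `r ∈ (1, ∞)` and some signed Radon measure `ω` of finite energy. -/
def Growth (κ : X → X → EReal) (A : Condenser X ι) (g : ι → X → ℝ) (i : ι) : Prop :=
  ∃ r : ℝ, 1 < r ∧ ∃ ω : SignedRadon X, ω.FiniteEnergy κ ∧
    NearlyEverywhere κ (A.plate i)
      fun x => ω.PotentialDefined κ x ∧ ((g i x ^ r : ℝ) : EReal) ≤ ω.pot κ x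

/-- The summability condition `∑ i, a i / inf_{A i} g i < ∞` (with `a / 0 = ∞` for `a > 0`). -/
def SummableCondition (A : Condenser X ι) (a : ι → ℝ) (g : ι → X → ℝ) : Prop :=
  (∑' i, ENNReal.ofReal (a i) / (⨅ x ∈ A.plate i, ENNReal.ofReal (g i x))) < ∞

/-- The kernel is bounded above on `A⁺ × A⁻`. -/
def KernelBounded (κ : X → X → EReal) (A : Condenser X ι) : Prop :=
  (⨆ x ∈ A.plusSet, ⨆ y ∈ A.minusSet, κ x y) < ⊤

end Condenser

end

end CondenserTheory

open CondenserTheory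

set_option linter.unusedSectionVars false

/-! Suppose the capacity is infinite. Then there are admissible `μ n` whose signed measures `p n - q
n` (`p n`, `q n` the positive and negative parts of `R`) have energy tending to `0`. The aim is to
contradict the fixed weighted mass `a j` on one plate. The analytic core is
`IsShift.vagueTendsto_zero`. If masses and energies are bounded, vague limits `p₀`, `q₀` exist along
an ultrafilter, and consistency makes the convergence weak. Expanding the nonnegative energy of `(p
n - q n) - (p₀ - q₀)` and passing to the limit shows that `p₀ - q₀` has energy zero. Strict
definiteness gives `p₀ = q₀`, and since the two limits live on disjoint closed sets, both vanish.
The energy bounds come from the kernel bound on `A⁺ × A⁻`, which controls the cross term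
(`IsShift.tendsto_zero_of_bound`). If `X` is compact, the measures are rescaled to total mass one.
The constant `1` is then a vague test function, so the total mass would have to tend to zero
(`IsShift.capacity_lt_top_of_compactSpace`). If `X` is not compact, the kernel is nonnegative, so
energies increase with the measures and the `j`-th coordinate has energy at most that of the part
containing it. By boundedness of `g j`, or by the growth condition and truncation, its mass stays
above some `s > 0` (`IsShift.exists_le_measure_univ`). By `C(A_j) < ∞`, measures on `A_j` of mass at
least `s` have energy at least some `δ > 0`. Without negative plates this contradicts the energies
tending to zero. Otherwise the coordinates are only weakly null, but a bounded weakly null sequence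
cannot stay in a convex set at positive distance from zero (`IsShift.false_of_weakly_null`). Radon
measures here need not be σ-finite, so symmetry of the energy rests on a Tonelli theorem for lower
semicontinuous kernels, proved by `τ`-additivity. -/

/-! ## Integrals of lower semicontinuous functions against Radon measures -/

/-- A step function of `t` with values in `[0, t]`, taking `m` steps of height `1`. -/
theorem sum_range_ite_lt_le (s : ℝ≥0∞) (m : ℕ) :
    ∑ k ∈ Finset.range m, (if ((k + 1 : ℕ) : ℝ≥0∞) < s then (1 : ℝ≥0∞) else 0) ≤ s := by
  induction m with
  | zero => simp
  | succ m ih =>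
    rw [Finset.sum_range_succ]
    split_ifs with h
    · refine le_trans ?_ h.le
      rw [Nat.cast_succ]
      gcongr
      calc _ ≤ ∑ k ∈ Finset.range m, (1 : ℝ≥0∞) := by
            gcongr
            split_ifs <;> simp
        _ = m := by simp
    · simpa using ih

/-- The strict inequality in the steps loses at most one unit. -/
theorem min_le_sum_range_ite_lt (s : ℝ≥0∞) (m : ℕ) :
    min s m ≤ 1 + ∑ k ∈ Finset.range m,
      (if ((k + 1 : ℕ) : ℝ≥0∞) < s then (1 : ℝ≥0∞) else 0) := by
  have hall : ∀ m : ℕ, (m : ℝ≥0∞) < s → ∑ k ∈ Finset.range m,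
      (if ((k + 1 : ℕ) : ℝ≥0∞) < s then (1 : ℝ≥0∞) else 0) = m := by
    intro m hm
    rw [Finset.sum_congr rfl (g := fun _ => 1)]
    · simp
    · intro k hk
      rw [if_pos]
      refine lt_of_le_of_lt ?_ hm
      exact_mod_cast Finset.mem_range.1 hk
  induction m with
  | zero => simp
  | succ m ih =>
    by_cases h : (m : ℝ≥0∞) < s
    · refine (min_le_right _ _).trans ?_
      rw [Finset.sum_range_succ, hall m h, Nat.cast_succ, add_comm]
      gcongr
      exact le_self_add
    · rw [Finset.sum_range_succ]
      push Not at h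
      rw [min_eq_left h] at ih
      exact (min_le_left _ _).trans (ih.trans (by gcongr; exact le_self_add))

/-- The step function with `N ^ 2` steps of height `1 / N`. -/
noncomputable def stepFun (N : ℕ) (t : ℝ≥0∞) : ℝ≥0∞ :=
  (N : ℝ≥0∞)⁻¹ * ∑ k ∈ Finset.range (N * N),
    (if ((k + 1 : ℕ) : ℝ≥0∞) < N * t then (1 : ℝ≥0∞) else 0)

theorem stepFun_le {N : ℕ} (hN : N ≠ 0) (t : ℝ≥0∞) : stepFun N t ≤ t := by
  have hN' : (N : ℝ≥0∞) ≠ 0 := by exact_mod_cast hN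
  calc stepFun N t ≤ (N : ℝ≥0∞)⁻¹ * (N * t) := by
        unfold stepFun; gcongr; exact sum_range_ite_lt_le _ _
    _ = t := by
        rw [← mul_assoc, ENNReal.inv_mul_cancel hN' (ENNReal.natCast_ne_top N), one_mul]

theorem min_le_stepFun {N : ℕ} (hN : N ≠ 0) (t : ℝ≥0∞) :
    min t N ≤ (N : ℝ≥0∞)⁻¹ + stepFun N t := by
  have hN' : (N : ℝ≥0∞) ≠ 0 := by exact_mod_cast hN
  have h := min_le_sum_range_ite_lt (N * t) (N * N)
  have h2 : min (N * t) ((N * N : ℕ) : ℝ≥0∞) = N * min t N := by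
    rw [Nat.cast_mul, mul_min]
  rw [h2] at h
  calc min t N = (N : ℝ≥0∞)⁻¹ * (N * min t N) := by
        rw [← mul_assoc, ENNReal.inv_mul_cancel hN' (ENNReal.natCast_ne_top N), one_mul]
    _ ≤ (N : ℝ≥0∞)⁻¹ * (1 + _) := by gcongr
    _ = _ := by rw [mul_add, mul_one]; rfl

/-- The steps miss at most `1 / N` below the height `N`, and both defects vanish in the limit. The
liminf form is the one needed for Fatou's lemma. -/
theorem le_liminf_stepFun (t : ℝ≥0∞) : t ≤ liminf (fun N : ℕ => stepFun (N + 1) t) atTop := by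
  have h1 : Tendsto (fun N : ℕ => min t ((N + 1 : ℕ) : ℝ≥0∞) - ((N + 1 : ℕ) : ℝ≥0∞)⁻¹) atTop
      (𝓝 (min t ⊤ - 0)) := by
    refine ENNReal.Tendsto.sub ?_ ?_ (Or.inr (by simp))
    · exact tendsto_const_nhds.min
        (ENNReal.tendsto_nat_nhds_top.comp (tendsto_add_atTop_nat 1))
    · exact ENNReal.tendsto_inv_nat_nhds_zero.comp (tendsto_add_atTop_nat 1)
  have h2 := h1.liminf_eq
  rw [min_top_right, tsub_zero] at h2
  conv_lhs => rw [← h2]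
  refine liminf_le_liminf (Eventually.of_forall fun N => ?_)
  exact tsub_le_iff_left.2 (min_le_stepFun (Nat.succ_ne_zero N) t)

/-! ### Directed suprema of lower semicontinuous functions -/

section LowerSemicontinuous

variable {X : Type*} [TopologicalSpace X] [MeasurableSpace X] [BorelSpace X]

/-- The index set may be uncountable: inner regularity reduces to compact sets, and a compact set
lies in a single member of a directed open cover. -/
theorem measure_iUnion_of_directed_isOpen {J : Type*} [Nonempty J] {μ : Measure X} [μ.Regular]
    {U : J → Set X} (hU : ∀ i, IsOpen (U i)) (hd : Directed (· ⊆ ·) U) :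
    μ (⋃ i, U i) = ⨆ i, μ (U i) := by
  refine le_antisymm ?_ (iSup_le fun i => measure_mono (subset_iUnion U i))
  rw [(isOpen_iUnion hU).measure_eq_iSup_isCompact]
  refine iSup₂_le fun K hKU => iSup_le fun hK => ?_
  obtain ⟨i, hi⟩ := hK.elim_directed_cover U hU hKU hd
  exact (measure_mono hi).trans (le_iSup (fun i => μ (U i)) i)

/-- A finite layer formula: only measures of open superlevel sets remain, so directed suprema can be
taken set by set. -/
theorem lintegral_stepFun {μ : Measure X} {N : ℕ} (hN : N ≠ 0) {f : X → ℝ≥0∞}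
    (hf : LowerSemicontinuous f) :
    ∫⁻ x, stepFun N (f x) ∂μ = (N : ℝ≥0∞)⁻¹ * ∑ k ∈ Finset.range (N * N),
      μ {x | ((k + 1 : ℕ) : ℝ≥0∞) / N < f x} := by
  have hN' : (N : ℝ≥0∞) ≠ 0 := by exact_mod_cast hN
  have hm : ∀ k : ℕ, MeasurableSet {x | ((k + 1 : ℕ) : ℝ≥0∞) / N < f x} := fun k =>
    (hf.isOpen_preimage _).measurableSet
  have hs : ∀ x, stepFun N (f x) = (N : ℝ≥0∞)⁻¹ * ∑ k ∈ Finset.range (N * N),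
      {x | ((k + 1 : ℕ) : ℝ≥0∞) / N < f x}.indicator 1 x := by
    intro x
    unfold stepFun
    congr 1
    refine Finset.sum_congr rfl fun k _ => ?_
    have hiff : ((k + 1 : ℕ) : ℝ≥0∞) / N < f x ↔ ((k + 1 : ℕ) : ℝ≥0∞) < N * f x := by
      rw [ENNReal.div_lt_iff (Or.inl hN') (Or.inl (ENNReal.natCast_ne_top N)), mul_comm]
    simp only [indicator, mem_ofPred_eq, hiff, Pi.one_apply]
  simp_rw [hs]
  rw [lintegral_const_mul, lintegral_finsetSum]
  · congr 1
    exact Finset.sum_congr rfl fun k _ => lintegral_indicator_one (hm k)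
  · exact fun k _ => measurable_one.indicator (hm k)
  · exact Finset.measurable_sum _ fun k _ => measurable_one.indicator (hm k)

/-- `τ`-additivity: the integral against a Radon measure commutes with directed suprema of lower
semicontinuous functions. -/
theorem lintegral_iSup_of_directed_lowerSemicontinuous {J : Type*} [Nonempty J] {μ : Measure X}
    [μ.Regular] {f : J → X → ℝ≥0∞} (hf : ∀ i, LowerSemicontinuous (f i))
    (hd : Directed (· ≤ ·) f) :
    ∫⁻ x, ⨆ i, f i x ∂μ = ⨆ i, ∫⁻ x, f i x ∂μ := by
  refine le_antisymm ?_ (iSup_le fun i => lintegral_mono fun x => le_iSup (fun i => f i x) i)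
  have hF : LowerSemicontinuous fun x => ⨆ i, f i x := lowerSemicontinuous_iSup hf
  have hmeas : ∀ N : ℕ, Measurable fun x => stepFun (N + 1) (⨆ i, f i x) := by
    intro N
    unfold stepFun
    refine Measurable.const_mul (Finset.measurable_sum _ fun k _ => ?_) _
    exact Measurable.ite (measurableSet_lt measurable_const (hF.measurable.const_mul _))
      measurable_const measurable_const
  -- Fatou handles the countable limit in `N`; for fixed `N` there are finitely many layers, so the
  -- directed supremum passes through the sum.
  calc ∫⁻ x, ⨆ i, f i x ∂μ
      ≤ ∫⁻ x, liminf (fun N : ℕ => stepFun (N + 1) (⨆ i, f i x)) atTop ∂μ :=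
        lintegral_mono fun x => le_liminf_stepFun _
    _ ≤ liminf (fun N : ℕ => ∫⁻ x, stepFun (N + 1) (⨆ i, f i x) ∂μ) atTop :=
        lintegral_liminf_le hmeas
    _ ≤ liminf (fun _ : ℕ => ⨆ i, ∫⁻ x, f i x ∂μ) atTop := by
        refine liminf_le_liminf (Eventually.of_forall fun N => ?_)
        have hN : N + 1 ≠ 0 := Nat.succ_ne_zero N
        rw [lintegral_stepFun hN hF]
        have hk : ∀ k : ℕ, μ {x | ((k + 1 : ℕ) : ℝ≥0∞) / (N + 1 : ℕ) < ⨆ i, f i x} =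
            ⨆ i, μ {x | ((k + 1 : ℕ) : ℝ≥0∞) / (N + 1 : ℕ) < f i x} := by
          intro k
          rw [← measure_iUnion_of_directed_isOpen
            (U := fun i => {x | ((k + 1 : ℕ) : ℝ≥0∞) / (N + 1 : ℕ) < f i x})
            (fun i => (hf i).isOpen_preimage _)]
          · congr 1
            ext x
            simp [lt_iSup_iff]
          · intro i j
            obtain ⟨l, hil, hjl⟩ := hd i j
            exact ⟨l, fun x hx => lt_of_lt_of_le hx (hil x), fun x hx => lt_of_lt_of_le hx (hjl x)⟩
        simp_rw [hk]
        rw [ENNReal.finsetSum_iSup, ENNReal.mul_iSup]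
        · refine iSup_mono fun i => ?_
          rw [← lintegral_stepFun hN (hf i)]
          exact lintegral_mono fun x => stepFun_le hN _
        · intro i j
          obtain ⟨l, hil, hjl⟩ := hd i j
          exact ⟨l, fun k => ⟨measure_mono fun x hx => lt_of_lt_of_le hx (hil x),
            measure_mono fun x hx => lt_of_lt_of_le hx (hjl x)⟩⟩
    _ = ⨆ i, ∫⁻ x, f i x ∂μ := by simp

end LowerSemicontinuous

/-- Nonnegative continuous functions with compact support below `k`. -/
def compactMinorants {Z : Type*} [TopologicalSpace Z] (k : Z → ℝ≥0∞) : Set (Z → ℝ) :=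
  {φ | Continuous φ ∧ HasCompactSupport φ ∧ (∀ z, 0 ≤ φ z) ∧ ∀ z, ENNReal.ofReal (φ z) ≤ k z}

theorem nonempty_compactMinorants {Z : Type*} [TopologicalSpace Z] (k : Z → ℝ≥0∞) :
    Nonempty (compactMinorants k) :=
  ⟨⟨fun _ => 0, continuous_const, HasCompactSupport.zero, by simp, by simp⟩⟩

theorem directed_compactMinorants {Z : Type*} [TopologicalSpace Z] (k : Z → ℝ≥0∞) :
    Directed (· ≤ ·) fun (φ : compactMinorants k) z => ENNReal.ofReal (φ.1 z) := by
  rintro ⟨φ, hφ, hφc, hφ0, hφk⟩ ⟨ψ, hψ, hψc, hψ0, hψk⟩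
  refine ⟨⟨fun z => max (φ z) (ψ z), hφ.max hψ, hφc.comp₂_left hψc (m := max) (max_self 0),
    fun z => (hφ0 z).trans (le_max_left _ _), fun z => ?_⟩, fun z => ?_, fun z => ?_⟩
  · rcases max_choice (φ z) (ψ z) with h | h <;> simp only [h]
    exacts [hφk z, hψk z]
  · exact ENNReal.ofReal_le_ofReal (le_max_left _ _)
  · exact ENNReal.ofReal_le_ofReal (le_max_right _ _)

/-- For `s < k z`, the function `s` times a Urysohn bump at `z` supported in the open set `{k > s}`
is a minorant with value `s` at `z`. -/
theorem LowerSemicontinuous.iSup_compactMinorants {Z : Type*} [TopologicalSpace Z] [T2Space Z]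
    [LocallyCompactSpace Z] {k : Z → ℝ≥0∞} (hk : LowerSemicontinuous k) (z : Z) :
    k z = ⨆ φ : compactMinorants k, ENNReal.ofReal (φ.1 z) := by
  refine le_antisymm (le_of_forall_lt fun r hr => ?_) (iSup_le fun φ => φ.2.2.2.2 z)
  obtain ⟨s, hrs, hsk⟩ := exists_between hr
  have hs : s ≠ ⊤ := hsk.ne_top
  obtain ⟨φ, hφ1, hφ0, hφc, hφ01⟩ := exists_continuous_one_zero_of_isCompact
    (isCompact_singleton (x := z)) (hk.isOpen_preimage s).isClosed_compl
    (disjoint_compl_right_iff_subset.2 (singleton_subset_iff.2 hsk))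
  have hle : ∀ y, ENNReal.ofReal (s.toReal * φ y) ≤ k y := by
    intro y
    by_cases hy : s < k y
    · refine le_trans ?_ hy.le
      rw [← ENNReal.ofReal_toReal hs]
      refine ENNReal.ofReal_le_ofReal ?_
      rw [ENNReal.toReal_ofReal ENNReal.toReal_nonneg]
      exact mul_le_of_le_one_right ENNReal.toReal_nonneg (hφ01 y).2
    · simp [hφ0 (show y ∈ (k ⁻¹' Ioi s)ᶜ from hy)]
  refine lt_of_lt_of_le hrs ?_
  refine le_trans ?_ (le_iSup (fun φ : compactMinorants k => ENNReal.ofReal (φ.1 z))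
    ⟨fun y => s.toReal * φ y, by fun_prop, hφc.mul_left,
      fun y => mul_nonneg ENNReal.toReal_nonneg (hφ01 y).1, hle⟩)
  simp [hφ1 (mem_singleton z), hs]

/-! ### Iterated integrals of lower semicontinuous kernels -/

section Tonelli

variable {X Y : Type*} [TopologicalSpace X] [T2Space X] [LocallyCompactSpace X]
  [MeasurableSpace X] [BorelSpace X] [TopologicalSpace Y] [T2Space Y] [LocallyCompactSpace Y]
  [MeasurableSpace Y] [BorelSpace Y]

theorem HasCompactSupport.of_uncurry_left {φ : X × Y → ℝ} (h : HasCompactSupport φ) (x : X) :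
    HasCompactSupport fun y => φ (x, y) := by
  refine HasCompactSupport.intro (h.isCompact.image continuous_snd) fun y hy => ?_
  by_contra hne
  exact hy ⟨(x, y), subset_tsupport _ hne, rfl⟩

theorem lintegral_ofReal_of_hasCompactSupport (ν : Measure Y) [ν.Regular] {φ : Y → ℝ}
    (hφ : Continuous φ) (hc : HasCompactSupport φ) (h0 : ∀ y, 0 ≤ φ y) :
    ∫⁻ y, ENNReal.ofReal (φ y) ∂ν = ENNReal.ofReal (∫ y, φ y ∂ν) :=
  (ofReal_integral_eq_lintegral_ofReal (hφ.integrable_of_hasCompactSupport hc)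
    (Eventually.of_forall h0)).symm

theorem continuous_integral_of_hasCompactSupport (ν : Measure Y) [ν.Regular] {φ : X × Y → ℝ}
    (hφ : Continuous φ) (hc : HasCompactSupport φ) :
    Continuous fun x => ∫ y, φ (x, y) ∂ν := by
  rw [← continuousOn_univ]
  refine continuousOn_integral_of_compact_support (f := fun x y => φ (x, y))
    (hc.isCompact.image continuous_snd) hφ.continuousOn fun x y _ hy => ?_
  by_contra hne
  exact hy ⟨(x, y), subset_tsupport _ hne, rfl⟩

theorem hasCompactSupport_integral (ν : Measure Y) {φ : X × Y → ℝ} (hc : HasCompactSupport φ) :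
    HasCompactSupport fun x => ∫ y, φ (x, y) ∂ν := by
  refine HasCompactSupport.intro (hc.isCompact.image continuous_fst) fun x hx => ?_
  have : ∀ y, φ (x, y) = 0 := fun y => by
    by_contra hne
    exact hx ⟨(x, y), subset_tsupport _ hne, rfl⟩
  simp [this]

theorem lintegral_eq_iSup_compactMinorants (ν : Measure Y) [ν.Regular] {k : X × Y → ℝ≥0∞}
    (hk : LowerSemicontinuous k) (x : X) :
    ∫⁻ y, k (x, y) ∂ν = ⨆ φ : compactMinorants k, ENNReal.ofReal (∫ y, φ.1 (x, y) ∂ν) := by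
  have := nonempty_compactMinorants k
  have hd : Directed (· ≤ ·) fun (φ : compactMinorants k) y => ENNReal.ofReal (φ.1 (x, y)) := by
    intro φ ψ
    obtain ⟨χ, h1, h2⟩ := directed_compactMinorants k φ ψ
    exact ⟨χ, fun y => h1 (x, y), fun y => h2 (x, y)⟩
  simp_rw [hk.iSup_compactMinorants]
  rw [lintegral_iSup_of_directed_lowerSemicontinuous _ hd]
  · refine iSup_congr fun φ => ?_
    exact lintegral_ofReal_of_hasCompactSupport ν (φ.2.1.comp (by fun_prop))
      (φ.2.2.1.of_uncurry_left x) fun y => φ.2.2.2.1 _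
  · intro φ
    exact (ENNReal.continuous_ofReal.comp (φ.2.1.comp (by fun_prop))).lowerSemicontinuous

theorem lowerSemicontinuous_lintegral (ν : Measure Y) [ν.Regular] {k : X × Y → ℝ≥0∞}
    (hk : LowerSemicontinuous k) : LowerSemicontinuous fun x => ∫⁻ y, k (x, y) ∂ν := by
  simp_rw [lintegral_eq_iSup_compactMinorants ν hk]
  exact lowerSemicontinuous_iSup fun φ => (ENNReal.continuous_ofReal.comp
    (continuous_integral_of_hasCompactSupport ν φ.2.1 φ.2.2.1)).lowerSemicontinuous

/-- `τ`-additivity is applied twice; the inner integrals of minorants are again continuous with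
compact support and directed. -/
theorem lintegral_lintegral_eq_iSup_compactMinorants (μ : Measure X) [μ.Regular] (ν : Measure Y)
    [ν.Regular] {k : X × Y → ℝ≥0∞} (hk : LowerSemicontinuous k) :
    ∫⁻ x, ∫⁻ y, k (x, y) ∂ν ∂μ =
      ⨆ φ : compactMinorants k, ENNReal.ofReal (∫ x, ∫ y, φ.1 (x, y) ∂ν ∂μ) := by
  have := nonempty_compactMinorants k
  simp_rw [lintegral_eq_iSup_compactMinorants ν hk]
  rw [lintegral_iSup_of_directed_lowerSemicontinuous]
  · refine iSup_congr fun φ => ?_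
    exact lintegral_ofReal_of_hasCompactSupport μ
      (continuous_integral_of_hasCompactSupport ν φ.2.1 φ.2.2.1)
      (hasCompactSupport_integral ν φ.2.2.1) fun x => integral_nonneg fun y => φ.2.2.2.1 _
  · exact fun φ => (ENNReal.continuous_ofReal.comp
      (continuous_integral_of_hasCompactSupport ν φ.2.1 φ.2.2.1)).lowerSemicontinuous
  · intro φ ψ
    obtain ⟨χ, h1, h2⟩ := directed_compactMinorants k φ ψ
    have key : ∀ φ : compactMinorants k, (∀ z, ENNReal.ofReal (φ.1 z) ≤ ENNReal.ofReal (χ.1 z)) →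
        ∀ x, ENNReal.ofReal (∫ y, φ.1 (x, y) ∂ν) ≤ ENNReal.ofReal (∫ y, χ.1 (x, y) ∂ν) := by
      intro φ h x
      have hint : ∀ φ : compactMinorants k, Integrable (fun y => φ.1 (x, y)) ν := fun φ =>
        (φ.2.1.comp (by fun_prop : Continuous fun y => (x, y))).integrable_of_hasCompactSupport
          (φ.2.2.1.of_uncurry_left x)
      exact ENNReal.ofReal_le_ofReal (integral_mono (hint φ) (hint χ) fun y =>
        (ENNReal.ofReal_le_ofReal_iff (χ.2.2.2.1 _)).1 (h (x, y)))
    exact ⟨χ, key φ h1, key ψ h2⟩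

/-- Tonelli's theorem for lower semicontinuous functions and Radon measures. -/
theorem lintegral_lintegral_swap_of_lowerSemicontinuous (μ : Measure X) [μ.Regular]
    (ν : Measure Y) [ν.Regular] {k : X × Y → ℝ≥0∞} (hk : LowerSemicontinuous k) :
    ∫⁻ x, ∫⁻ y, k (x, y) ∂ν ∂μ = ∫⁻ y, ∫⁻ x, k (x, y) ∂μ ∂ν := by
  have hk' : LowerSemicontinuous fun p : Y × X => k p.swap := hk.comp continuous_swap
  have h2 := lintegral_lintegral_eq_iSup_compactMinorants ν μ hk'
  simp only [Prod.swap_prod_mk] at h2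
  rw [h2, lintegral_lintegral_eq_iSup_compactMinorants μ ν hk]
  -- Swapping variables exchanges the minorants of the two kernels, and Fubini for continuous
  -- compactly supported functions needs no σ-finiteness.
  refine le_antisymm (iSup_le fun φ => ?_) (iSup_le fun φ => ?_)
  · refine le_trans (le_of_eq ?_) (le_iSup _ ⟨fun p => φ.1 p.swap, φ.2.1.comp continuous_swap,
      φ.2.2.1.comp_homeomorph (Homeomorph.prodComm Y X), fun p => φ.2.2.2.1 _,
      fun p => φ.2.2.2.2 _⟩)
    rw [integral_integral_swap_of_hasCompactSupport (f := fun x y => φ.1 (x, y)) φ.2.1 φ.2.2.1]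
    rfl
  · refine le_trans (le_of_eq ?_) (le_iSup _ ⟨fun p => φ.1 p.swap, φ.2.1.comp continuous_swap,
      φ.2.2.1.comp_homeomorph (Homeomorph.prodComm X Y), fun p => φ.2.2.2.1 _,
      fun p => φ.2.2.2.2 p.swap⟩)
    rw [integral_integral_swap_of_hasCompactSupport (f := fun x y => φ.1 (x, y)) φ.2.1 φ.2.2.1]
    rfl

end Tonelli

open scoped NNReal CompactlySupported

/-! ## Energies of measures of finite energy -/

section Energy

variable {X : Type*} [TopologicalSpace X] [T2Space X] [LocallyCompactSpace X] [MeasurableSpace X]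
  [BorelSpace X]

/-- If `f = g - c` with `g ≥ 0` and a constant `c ≥ 0`, the integral of `f` is `∫ g - c ν(X)`. -/
theorem eintegral_sub_const {ν : Measure X} {g : X → ℝ≥0∞} (hg : Measurable g) {c : ℝ≥0∞}
    (hc : c * ν univ ≠ ⊤) :
    eintegral ν (fun x => (g x : EReal) - (c : EReal)) =
      ((∫⁻ x, g x ∂ν : ℝ≥0∞) : EReal) - ((c * ν univ : ℝ≥0∞) : EReal) := by
  rcases eq_or_ne c ⊤ with rfl | hc'
  · have h0 : ν univ = 0 := by
      by_contra h
      exact hc (ENNReal.top_mul h)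
    have : ν = 0 := Measure.measure_univ_eq_zero.1 h0
    subst this
    simp [eintegral]
  have h1 : ∀ x, ((g x : EReal) - (c : EReal)).toENNReal = g x - c := fun x => by
    rw [EReal.toENNReal_sub (EReal.coe_ennreal_nonneg c)]
    simp
  have h2 : ∀ x, (-((g x : EReal) - (c : EReal))).toENNReal = c - g x := fun x => by
    rw [EReal.neg_sub (Or.inl (by simp)) (Or.inr (by simpa using hc')), add_comm,
      ← sub_eq_add_neg, EReal.toENNReal_sub (EReal.coe_ennreal_nonneg _)]
    simp
  unfold eintegral
  simp_rw [h1, h2]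
  -- With truncated subtraction, `(g - c) + c = max g c = g + (c - g)`; integrating this avoids any
  -- `∞ - ∞`.
  have h3 : ∫⁻ x, (g x - c) ∂ν + c * ν univ = ∫⁻ x, g x ∂ν + ∫⁻ x, (c - g x) ∂ν := by
    rw [← lintegral_const, ← lintegral_add_right _ measurable_const, ← lintegral_add_left hg]
    refine lintegral_congr fun x => ?_
    rw [tsub_add_eq_max, add_comm, tsub_add_eq_max, max_comm]
  have h4 : ∫⁻ x, (c - g x) ∂ν ≠ ⊤ := by
    refine ne_top_of_le_ne_top hc ?_
    rw [← lintegral_const]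
    exact lintegral_mono fun x => tsub_le_self
  generalize ∫⁻ x, (g x - c) ∂ν = A at *
  generalize ∫⁻ x, (c - g x) ∂ν = D at *
  generalize ∫⁻ x, g x ∂ν = G at *
  generalize c * ν univ = C at *
  lift C to ℝ≥0 using hc
  lift D to ℝ≥0 using h4
  induction A with
  | top =>
    have : G = ⊤ := by
      by_contra h
      rw [top_add] at h3
      exact ENNReal.add_ne_top.2 ⟨h, ENNReal.coe_ne_top⟩ h3.symm
    subst this
    have h : ∀ r : ℝ≥0, (⊤ : EReal) - ((r : ℝ≥0∞) : EReal) = ⊤ := fun r => EReal.top_sub_coe r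
    simp [h]
  | coe A =>
    have : G ≠ ⊤ := fun h => by
      rw [h, top_add] at h3
      exact ENNReal.add_ne_top.2 ⟨ENNReal.coe_ne_top, ENNReal.coe_ne_top⟩ h3
    lift G to ℝ≥0 using this
    have h5 : (A : ℝ) + C = G + D := by exact_mod_cast h3
    change (((A : ℝ) : EReal) - ((D : ℝ) : EReal)) = ((G : ℝ) : EReal) - ((C : ℝ) : EReal)
    rw [← EReal.coe_sub, ← EReal.coe_sub]
    congr 1
    linarith

/-- A representation `κ = k - c` of a symmetric kernel with `k ≥ 0` and a constant `c ≥ 0`, which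
is zero unless `X` is compact. -/
structure IsShift (κ : X → X → EReal) (k : X × X → ℝ≥0∞) (c : ℝ≥0) : Prop where
  lsc : LowerSemicontinuous k
  eq_zero : ¬ CompactSpace X → c = 0
  eq_sub : ∀ x y, κ x y = (k (x, y) : EReal) - ((c : ℝ≥0∞) : EReal)
  symm : ∀ x y, k (x, y) = k (y, x)

/-- On a compact space a lower semicontinuous kernel attains its minimum, so a finite constant makes
it nonnegative. -/
theorem CondenserTheory.IsKernel.exists_isShift {κ : X → X → EReal} (hκ : IsKernel κ)
    (hs : ∀ x y, κ x y = κ y x) : ∃ k c, IsShift κ k c := by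
  obtain ⟨c, hc0, hc⟩ : ∃ c : ℝ≥0, (¬ CompactSpace X → c = 0) ∧
      ∀ x y, 0 ≤ κ x y + ((c : ℝ≥0∞) : EReal) := by
    by_cases hX : CompactSpace X
    · rcases isEmpty_or_nonempty X with he | he
      · exact ⟨0, fun _ => rfl, fun x => he.elim x⟩
      obtain ⟨p, -, hp⟩ := LowerSemicontinuousOn.exists_isMinOn (s := (univ : Set (X × X)))
        univ_nonempty isCompact_univ (hκ.lsc.lowerSemicontinuousOn _)
      have hp' : ∀ x y, κ p.1 p.2 ≤ κ x y := fun x y => hp (mem_univ (x, y))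
      rcases eq_or_ne (κ p.1 p.2) ⊤ with htop | htop
      · refine ⟨0, fun _ => rfl, fun x y => ?_⟩
        have := top_le_iff.1 (htop ▸ hp' x y)
        simp [this]
      · refine ⟨(-(κ p.1 p.2).toReal).toNNReal, fun h => (h hX).elim, fun x y => ?_⟩
        have h1 : (((-(κ p.1 p.2).toReal).toNNReal : ℝ) : EReal) =
          (((-(κ p.1 p.2).toReal).toNNReal : ℝ≥0∞) : EReal) := rfl
        rw [← h1]
        refine le_trans ?_ (add_le_add_left (hp' x y) _)
        rw [← EReal.coe_toReal htop (hκ.ne_bot _ _), ← EReal.coe_add, EReal.toReal_coe]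
        have := Real.le_coe_toNNReal (-(κ p.1 p.2).toReal)
        exact EReal.coe_nonneg.2 (by linarith)
    · exact ⟨0, fun _ => rfl, fun x y => by simpa using hκ.nonneg hX x y⟩
  refine ⟨fun p => (κ p.1 p.2 + ((c : ℝ≥0∞) : EReal)).toENNReal, c, ?_, hc0, ?_, ?_⟩
  · have hcont : Continuous fun t : EReal => (t + ((c : ℝ≥0∞) : EReal)).toENNReal := by
      refine EReal.continuous_toENNReal.comp (continuous_iff_continuousAt.2 fun t => ?_)
      exact (EReal.continuousAt_add (p := (t, ((c : ℝ≥0∞) : EReal))) (Or.inr (by simp))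
        (Or.inr (by simp))).comp (f := fun t : EReal => (t, ((c : ℝ≥0∞) : EReal)))
        (by fun_prop)
    exact hcont.comp_lowerSemicontinuous hκ.lsc fun s t hst =>
      EReal.toENNReal_le_toENNReal (add_le_add_left hst _)
  · intro x y
    rw [EReal.coe_toENNReal (hc x y)]
    exact (EReal.add_sub_cancel_right (b := (c : ℝ))).symm
  · intro x y
    simp only [hs x y]

/-- The mutual energy with respect to a nonnegative kernel. -/
noncomputable def nnEnergy (k : X × X → ℝ≥0∞) (ν μ : Measure X) : ℝ≥0∞ :=
  ∫⁻ x, ∫⁻ y, k (x, y) ∂μ ∂ν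

/-! ### The energy as a real bilinear form -/

section Shift

variable {κ : X → X → EReal} {k : X × X → ℝ≥0∞} {c : ℝ≥0} {ν ν' μ : Measure X}

/-- Either `X` is compact and the total mass is finite, or the constant vanishes and `0 * ∞ = 0`.
This keeps every correction term finite. -/
theorem IsShift.mul_measure_ne_top (h : IsShift κ k c) [ν.Regular] {d : ℝ≥0∞} (hd : d ≠ ⊤)
    (hd0 : c = 0 → d = 0) : d * ν univ ≠ ⊤ := by
  by_cases hX : CompactSpace X
  · exact ENNReal.mul_ne_top hd isCompact_univ.measure_ne_top
  · simp [hd0 (h.eq_zero hX)]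

theorem IsShift.mul_mul_ne_top (h : IsShift κ k c) (hν : ν.Regular) (hμ : μ.Regular) :
    (c : ℝ≥0∞) * μ univ * ν univ ≠ ⊤ :=
  h.mul_measure_ne_top (h.mul_measure_ne_top ENNReal.coe_ne_top (by simp)) fun h => by simp [h]

theorem IsShift.potential_eq (h : IsShift κ k c) [μ.Regular] (x : X) :
    potential κ μ x =
      ((∫⁻ y, k (x, y) ∂μ : ℝ≥0∞) : EReal) - ((c * μ univ : ℝ≥0∞) : EReal) := by
  have hm : Measurable fun y => k (x, y) := (h.lsc.comp (by fun_prop)).measurable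
  rw [← eintegral_sub_const hm (h.mul_measure_ne_top ENNReal.coe_ne_top (by simp))]
  simp only [potential, ← h.eq_sub]

theorem IsShift.mutualEnergy_eq (h : IsShift κ k c) (hν : ν.Regular) (hμ : μ.Regular) :
    mutualEnergy κ ν μ =
      (nnEnergy k ν μ : EReal) - ((c * μ univ * ν univ : ℝ≥0∞) : EReal) := by
  unfold nnEnergy
  rw [← eintegral_sub_const (lowerSemicontinuous_lintegral μ h.lsc).measurable
    (h.mul_mul_ne_top hν hμ)]
  simp only [mutualEnergy, ← h.potential_eq]

theorem nnEnergy_add_left : nnEnergy k (ν + ν') μ = nnEnergy k ν μ + nnEnergy k ν' μ :=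
  lintegral_add_measure _ _ _

theorem nnEnergy_smul_left (t : ℝ≥0∞) : nnEnergy k (t • ν) μ = t * nnEnergy k ν μ := by
  simp [nnEnergy]

theorem nnEnergy_mono_left (h : ν ≤ ν') : nnEnergy k ν μ ≤ nnEnergy k ν' μ :=
  lintegral_mono' h le_rfl

theorem nnEnergy_mono_right (h : ν ≤ ν') : nnEnergy k μ ν ≤ nnEnergy k μ ν' :=
  lintegral_mono fun _ => lintegral_mono' h le_rfl

theorem IsShift.nnEnergy_comm (h : IsShift κ k c) (hν : ν.Regular) (hμ : μ.Regular) :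
    nnEnergy k ν μ = nnEnergy k μ ν := by
  unfold nnEnergy
  rw [lintegral_lintegral_swap_of_lowerSemicontinuous ν μ h.lsc]
  simp_rw [h.symm]

theorem coe_sub_coe_eq_top_iff {a b : ℝ≥0∞} (hb : b ≠ ⊤) : (a : EReal) - b = ⊤ ↔ a = ⊤ := by
  lift b to ℝ≥0 using hb
  induction a with
  | top => simp
  | coe a =>
    simp only [ENNReal.coe_ne_top, iff_false]
    exact EReal.coe_ne_top ((a : ℝ) - b)

theorem coe_sub_coe_ne_bot {a b : ℝ≥0∞} (hb : b ≠ ⊤) : (a : EReal) - b ≠ ⊥ := by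
  lift b to ℝ≥0 using hb
  induction a with
  | top =>
    simp
  | coe a => exact EReal.coe_ne_bot ((a : ℝ) - b)

theorem IsShift.mutualEnergy_ne_bot (h : IsShift κ k c) (hν : ν.Regular) (hμ : μ.Regular) :
    mutualEnergy κ ν μ ≠ ⊥ := by
  rw [h.mutualEnergy_eq hν hμ]
  exact coe_sub_coe_ne_bot (h.mul_mul_ne_top hν hμ)

theorem IsShift.mutualEnergy_eq_top_iff (h : IsShift κ k c) (hν : ν.Regular) (hμ : μ.Regular) :
    mutualEnergy κ ν μ = ⊤ ↔ nnEnergy k ν μ = ⊤ := by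
  rw [h.mutualEnergy_eq hν hμ]
  exact coe_sub_coe_eq_top_iff (h.mul_mul_ne_top hν hμ)

theorem IsShift.finiteEnergyPlus_iff (h : IsShift κ k c) :
    FiniteEnergyPlus κ ν ↔ ν.Regular ∧ nnEnergy k ν ν ≠ ⊤ := by
  constructor
  · rintro ⟨hν, -, h2⟩
    exact ⟨hν, fun htop => h2.ne ((h.mutualEnergy_eq_top_iff hν hν).2 htop)⟩
  · rintro ⟨hν, h2⟩
    refine ⟨hν, bot_lt_iff_ne_bot.2 (h.mutualEnergy_ne_bot hν hν), lt_top_iff_ne_top.2 ?_⟩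
    rwa [Ne, h.mutualEnergy_eq_top_iff hν hν]

/-- If the mutual energy were infinite, `ν - μ` would have well-defined energy `-∞`, against
positive definiteness. -/
theorem IsShift.nnEnergy_ne_top (h : IsShift κ k c) (hpd : PositiveDefinite κ)
    (hν : FiniteEnergyPlus κ ν) (hμ : FiniteEnergyPlus κ μ) : nnEnergy k ν μ ≠ ⊤ := by
  intro htop
  have hν' := hν.1
  have hμ' := hμ.1
  let σ : SignedRadon X := ⟨ν, μ, hν', hμ'⟩
  have hplus : σ.energyPlus κ ≠ ⊤ := by
    refine (EReal.add_lt_top hν.2.2.ne hμ.2.2.ne).ne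
  have hminus : σ.energyMinus κ = ⊤ := by
    change mutualEnergy κ ν μ + mutualEnergy κ μ ν = ⊤
    rw [(h.mutualEnergy_eq_top_iff hν' hμ').2 htop,
      EReal.top_add_of_ne_bot (h.mutualEnergy_ne_bot hμ' hν')]
  have hpos := hpd.2 σ fun hh => hplus hh.1
  rw [SignedRadon.energy, hminus, EReal.sub_top] at hpos
  simp at hpos

/-- The mutual energy as a real number. -/
noncomputable def energyForm (κ : X → X → EReal) (ν μ : Measure X) : ℝ :=
  (mutualEnergy κ ν μ).toReal

theorem IsShift.coe_energyForm (h : IsShift κ k c) (hpd : PositiveDefinite κ)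
    (hν : FiniteEnergyPlus κ ν) (hμ : FiniteEnergyPlus κ μ) :
    (energyForm κ ν μ : EReal) = mutualEnergy κ ν μ :=
  EReal.coe_toReal
    (fun ht => h.nnEnergy_ne_top hpd hν hμ ((h.mutualEnergy_eq_top_iff hν.1 hμ.1).1 ht))
    (h.mutualEnergy_ne_bot hν.1 hμ.1)

theorem IsShift.energyForm_eq (h : IsShift κ k c) (hpd : PositiveDefinite κ)
    (hν : FiniteEnergyPlus κ ν) (hμ : FiniteEnergyPlus κ μ) :
    energyForm κ ν μ = (nnEnergy k ν μ).toReal - (c * μ univ * ν univ : ℝ≥0∞).toReal := by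
  have h1 := h.coe_energyForm hpd hν hμ
  rw [h.mutualEnergy_eq hν.1 hμ.1, ← EReal.coe_ennreal_toReal (h.nnEnergy_ne_top hpd hν hμ),
    ← EReal.coe_ennreal_toReal (h.mul_mul_ne_top hν.1 hμ.1), ← EReal.coe_sub] at h1
  exact_mod_cast h1

theorem IsShift.energyForm_comm (h : IsShift κ k c) (hpd : PositiveDefinite κ)
    (hν : FiniteEnergyPlus κ ν) (hμ : FiniteEnergyPlus κ μ) :
    energyForm κ ν μ = energyForm κ μ ν := by
  rw [h.energyForm_eq hpd hν hμ, h.energyForm_eq hpd hμ hν, h.nnEnergy_comm hν.1 hμ.1,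
    mul_right_comm]

theorem regular_add (hν : ν.Regular) (hμ : μ.Regular) : (ν + μ).Regular := by
  have h := regular_sum (X := X) (ι := Bool) (fun _ => univ) (fun _ => isClosed_univ)
    (fun _ _ => Set.toFinite _) (fun b => cond b ν μ) (by rintro (_ | _) <;> assumption) (by simp)
  rwa [Measure.sum_bool] at h

theorem IsShift.finiteEnergyPlus_add (h : IsShift κ k c) (hpd : PositiveDefinite κ)
    (hν : FiniteEnergyPlus κ ν) (hμ : FiniteEnergyPlus κ μ) : FiniteEnergyPlus κ (ν + μ) := by
  have hr := regular_add hν.1 hμ.1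
  refine h.finiteEnergyPlus_iff.2 ⟨hr, ?_⟩
  rw [nnEnergy_add_left, h.nnEnergy_comm hν.1 hr, h.nnEnergy_comm hμ.1 hr, nnEnergy_add_left,
    nnEnergy_add_left]
  simp [h.nnEnergy_ne_top hpd, hν, hμ]

theorem IsShift.finiteEnergyPlus_smul (h : IsShift κ k c)
    (hν : FiniteEnergyPlus κ ν) {t : ℝ≥0∞} (ht : t ≠ ⊤) : FiniteEnergyPlus κ (t • ν) := by
  have := hν.1
  have hr : (t • ν).Regular := Measure.Regular.smul ht
  refine h.finiteEnergyPlus_iff.2 ⟨hr, ?_⟩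
  rw [nnEnergy_smul_left, h.nnEnergy_comm hν.1 hr, nnEnergy_smul_left]
  exact ENNReal.mul_ne_top ht (ENNReal.mul_ne_top ht (h.finiteEnergyPlus_iff.1 hν).2)

theorem IsShift.finiteEnergyPlus_of_le (h : IsShift κ k c) (hν : FiniteEnergyPlus κ ν)
    (hμ : μ.Regular) (hle : μ ≤ ν) : FiniteEnergyPlus κ μ :=
  h.finiteEnergyPlus_iff.2 ⟨hμ, ne_top_of_le_ne_top (h.finiteEnergyPlus_iff.1 hν).2
    ((nnEnergy_mono_left hle).trans (nnEnergy_mono_right hle))⟩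

theorem IsShift.finiteEnergyPlus_zero (h : IsShift κ k c) : FiniteEnergyPlus κ (0 : Measure X) :=
  h.finiteEnergyPlus_iff.2 ⟨inferInstance, by simp [nnEnergy]⟩

theorem energyForm_zero_left : energyForm κ 0 μ = 0 := by
  simp [energyForm, mutualEnergy, eintegral]

theorem IsShift.energyForm_add_left (h : IsShift κ k c) (hpd : PositiveDefinite κ)
    (hν : FiniteEnergyPlus κ ν) (hν' : FiniteEnergyPlus κ ν') (hμ : FiniteEnergyPlus κ μ) :
    energyForm κ (ν + ν') μ = energyForm κ ν μ + energyForm κ ν' μ := by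
  rw [h.energyForm_eq hpd (h.finiteEnergyPlus_add hpd hν hν') hμ, h.energyForm_eq hpd hν hμ,
    h.energyForm_eq hpd hν' hμ, nnEnergy_add_left, Measure.add_apply, mul_add,
    ENNReal.toReal_add (h.nnEnergy_ne_top hpd hν hμ) (h.nnEnergy_ne_top hpd hν' hμ),
    ENNReal.toReal_add (h.mul_mul_ne_top hν.1 hμ.1) (h.mul_mul_ne_top hν'.1 hμ.1)]
  ring

theorem IsShift.energyForm_add_right (h : IsShift κ k c) (hpd : PositiveDefinite κ)
    (hν : FiniteEnergyPlus κ ν) (hν' : FiniteEnergyPlus κ ν') (hμ : FiniteEnergyPlus κ μ) :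
    energyForm κ μ (ν + ν') = energyForm κ μ ν + energyForm κ μ ν' := by
  rw [h.energyForm_comm hpd hμ (h.finiteEnergyPlus_add hpd hν hν'),
    h.energyForm_add_left hpd hν hν' hμ, h.energyForm_comm hpd hμ hν, h.energyForm_comm hpd hμ hν']

theorem IsShift.energyForm_smul_left (h : IsShift κ k c) (hpd : PositiveDefinite κ)
    (hν : FiniteEnergyPlus κ ν) (hμ : FiniteEnergyPlus κ μ) {t : ℝ≥0∞} (ht : t ≠ ⊤) :
    energyForm κ (t • ν) μ = t.toReal * energyForm κ ν μ := by
  rw [h.energyForm_eq hpd (h.finiteEnergyPlus_smul hν ht) hμ, h.energyForm_eq hpd hν hμ,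
    nnEnergy_smul_left, Measure.smul_apply, smul_eq_mul, mul_left_comm, ENNReal.toReal_mul,
    ENNReal.toReal_mul, mul_sub]

theorem IsShift.energyForm_smul_right (h : IsShift κ k c) (hpd : PositiveDefinite κ)
    (hν : FiniteEnergyPlus κ ν) (hμ : FiniteEnergyPlus κ μ) {t : ℝ≥0∞} (ht : t ≠ ⊤) :
    energyForm κ μ (t • ν) = t.toReal * energyForm κ μ ν := by
  rw [h.energyForm_comm hpd hμ (h.finiteEnergyPlus_smul hν ht),
    h.energyForm_smul_left hpd hν hμ ht, h.energyForm_comm hpd hμ hν]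

theorem IsShift.energyForm_smul_smul (h : IsShift κ k c) (hpd : PositiveDefinite κ)
    (hν : FiniteEnergyPlus κ ν) (hμ : FiniteEnergyPlus κ μ) {t : ℝ≥0∞} (ht : t ≠ ⊤) :
    energyForm κ (t • ν) (t • μ) = t.toReal ^ 2 * energyForm κ ν μ := by
  rw [h.energyForm_smul_right hpd hμ (h.finiteEnergyPlus_smul hν ht) ht,
    h.energyForm_smul_left hpd hν hμ ht]
  ring

/-- The energy of a difference of two measures of finite energy. -/
theorem IsShift.energy_eq (h : IsShift κ k c) (hpd : PositiveDefinite κ) {σ : SignedRadon X}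
    (hp : FiniteEnergyPlus κ σ.pos) (hn : FiniteEnergyPlus κ σ.neg) :
    σ.energy κ = ((energyForm κ σ.pos σ.pos + energyForm κ σ.neg σ.neg -
      2 * energyForm κ σ.pos σ.neg : ℝ) : EReal) := by
  rw [SignedRadon.energy, SignedRadon.energyPlus, SignedRadon.energyMinus,
    ← h.coe_energyForm hpd hp hp, ← h.coe_energyForm hpd hn hn, ← h.coe_energyForm hpd hp hn,
    ← h.coe_energyForm hpd hn hp, h.energyForm_comm hpd hn hp, ← EReal.coe_add, ← EReal.coe_add,
    ← EReal.coe_sub, two_mul]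

theorem IsShift.energyDefined (h : IsShift κ k c) (hpd : PositiveDefinite κ) {σ : SignedRadon X}
    (hp : FiniteEnergyPlus κ σ.pos) (hn : FiniteEnergyPlus κ σ.neg) : σ.EnergyDefined κ := by
  intro hh
  have := hh.1
  rw [SignedRadon.energyPlus, ← h.coe_energyForm hpd hp hp, ← h.coe_energyForm hpd hn hn,
    ← EReal.coe_add] at this
  exact EReal.coe_ne_top _ this

theorem IsShift.finiteEnergy (h : IsShift κ k c) (hpd : PositiveDefinite κ) {σ : SignedRadon X}
    (hp : FiniteEnergyPlus κ σ.pos) (hn : FiniteEnergyPlus κ σ.neg) : σ.FiniteEnergy κ := by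
  refine ⟨h.energyDefined hpd hp hn, ?_⟩
  rw [h.energy_eq hpd hp hn]
  exact ⟨EReal.bot_lt_coe _, EReal.coe_lt_top _⟩

/-- An infinite positive contribution would, by definedness, make the whole energy `+∞`. Hence the
sum of the two self-energies is finite, and so is each, since neither is `-∞`. -/
theorem IsShift.finiteEnergyPlus_of_finiteEnergy (h : IsShift κ k c) {σ : SignedRadon X}
    (hσ : σ.FiniteEnergy κ) : FiniteEnergyPlus κ σ.pos ∧ FiniteEnergyPlus κ σ.neg := by
  have hp := σ.regular_pos
  have hn := σ.regular_neg
  have hplus : σ.energyPlus κ ≠ ⊤ := by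
    intro hh
    have hm : σ.energyMinus κ ≠ ⊤ := fun h' => hσ.1 ⟨hh, h'⟩
    have := hσ.2.2.ne
    rw [SignedRadon.energy, hh, EReal.top_sub hm] at this
    exact this rfl
  rw [SignedRadon.energyPlus] at hplus
  refine ⟨⟨hp, bot_lt_iff_ne_bot.2 (h.mutualEnergy_ne_bot hp hp), lt_top_iff_ne_top.2 fun ht =>
    hplus ?_⟩, ⟨hn, bot_lt_iff_ne_bot.2 (h.mutualEnergy_ne_bot hn hn), lt_top_iff_ne_top.2 fun ht =>
    hplus ?_⟩⟩
  · rw [ht, EReal.top_add_of_ne_bot (h.mutualEnergy_ne_bot hn hn)]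
  · rw [ht, EReal.add_top_of_ne_bot (h.mutualEnergy_ne_bot hp hp)]

/-- This is positivity of the energy of `ν - μ`; it replaces Cauchy–Schwarz throughout. -/
theorem IsShift.two_mul_energyForm_le (h : IsShift κ k c) (hpd : PositiveDefinite κ)
    (hν : FiniteEnergyPlus κ ν) (hμ : FiniteEnergyPlus κ μ) :
    2 * energyForm κ ν μ ≤ energyForm κ ν ν + energyForm κ μ μ := by
  let σ : SignedRadon X := ⟨ν, μ, hν.1, hμ.1⟩
  have h1 := hpd.2 σ (h.energyDefined hpd (σ := σ) hν hμ)
  rw [h.energy_eq hpd (σ := σ) hν hμ] at h1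
  have := EReal.coe_nonneg.1 h1
  linarith

theorem IsShift.energyForm_self_nonneg (h : IsShift κ k c) (hpd : PositiveDefinite κ)
    (hν : FiniteEnergyPlus κ ν) : 0 ≤ energyForm κ ν ν := by
  have := h.two_mul_energyForm_le hpd hν h.finiteEnergyPlus_zero
  rw [h.energyForm_comm hpd hν h.finiteEnergyPlus_zero, energyForm_zero_left,
    energyForm_zero_left] at this
  linarith

end Shift

end Energy

/-! ## Vague limits -/

section Vague

variable {X : Type*} [TopologicalSpace X] [T2Space X] [LocallyCompactSpace X] [MeasurableSpace X]
  [BorelSpace X]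

theorem vagueTendsto_map_iff {ι : Type*} {l : Filter ι} {p : ι → Measure X} {p₀ : Measure X} :
    VagueTendsto (l.map p) p₀ ↔ ∀ φ : X → ℝ, Continuous φ → HasCompactSupport φ →
      Tendsto (fun n => ∫ x, φ x ∂(p n)) l (𝓝 (∫ x, φ x ∂p₀)) := by
  simp only [VagueTendsto, tendsto_map'_iff, Function.comp_def]

/-- Radon measures of bounded mass are relatively compact for the vague topology. -/
theorem exists_vagueTendsto {ι : Type*} (U : Ultrafilter ι) {p : ι → Measure X}
    (hp : ∀ n, (p n).Regular) {M : ℝ} (hM : ∀ n, p n univ ≤ ENNReal.ofReal M) :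
    ∃ p₀ : Measure X, p₀.Regular ∧ VagueTendsto (Filter.map p U) p₀ := by
  have hfin : ∀ n, IsFiniteMeasure (p n) := fun n =>
    ⟨(hM n).trans_lt ENNReal.ofReal_lt_top⟩
  have hint : ∀ (φ : C_c(X, ℝ)) (n : ι), Integrable φ (p n) := fun φ n =>
    φ.1.continuous.integrable_of_hasCompactSupport φ.2
  -- Each sequence of integrals stays in a compact ball, so it converges along the ultrafilter. The
  -- limits form a positive linear functional, represented by a Radon measure through Riesz–Markov.
  have hlim : ∀ φ : C_c(X, ℝ), ∃ t : ℝ, Tendsto (fun n => ∫ x, φ x ∂(p n)) U (𝓝 t) := by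
    intro φ
    obtain ⟨C, hC⟩ := φ.2.exists_bound_of_continuous φ.1.continuous
    have hbd : ∀ n, ∫ x, φ x ∂(p n) ∈ Metric.closedBall (0 : ℝ) (max C 0 * max M 0) := by
      intro n
      rw [mem_closedBall_zero_iff]
      refine (norm_integral_le_of_norm_le_const (C := max C 0)
        (Eventually.of_forall fun x => (hC x).trans (le_max_left _ _))).trans ?_
      refine mul_le_mul_of_nonneg_left ?_ (le_max_right _ _)
      refine ENNReal.toReal_le_of_le_ofReal (le_max_right _ _) ((hM n).trans ?_)
      exact ENNReal.ofReal_le_ofReal (le_max_left _ _)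
    obtain ⟨t, -, ht⟩ := (isCompact_closedBall (0 : ℝ) (max C 0 * max M 0)).ultrafilter_le_nhds
      (U.map fun n => ∫ x, φ x ∂(p n)) (le_principal_iff.2 (Ultrafilter.mem_map.2
        (Filter.univ_mem' hbd)))
    exact ⟨t, ht⟩
  choose Λ hΛ using hlim
  let T : C_c(X, ℝ) →ₗ[ℝ] ℝ :=
    { toFun := Λ
      map_add' := fun φ ψ => tendsto_nhds_unique (hΛ (φ + ψ)) (by
        refine ((hΛ φ).add (hΛ ψ)).congr fun n => ?_
        exact (integral_add (hint φ n) (hint ψ n)).symm)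
      map_smul' := fun r φ => tendsto_nhds_unique (hΛ (r • φ)) (by
        refine ((hΛ φ).const_mul r).congr fun n => ?_
        exact (integral_const_mul r _).symm) }
  have hT : ∀ φ, 0 ≤ φ → 0 ≤ T φ := fun φ hφ =>
    ge_of_tendsto (hΛ φ) (Eventually.of_forall fun n => integral_nonneg fun x => hφ x)
  let S : C_c(X, ℝ) →ₚ[ℝ] ℝ := PositiveLinearMap.mk₀ T hT
  refine ⟨RealRMK.rieszMeasure S, inferInstance, vagueTendsto_map_iff.2 fun φ hφ hc => ?_⟩
  let φ' : C_c(X, ℝ) := ⟨⟨φ, hφ⟩, hc⟩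
  have := RealRMK.integral_rieszMeasure S φ'
  change ∫ x, φ x ∂(RealRMK.rieszMeasure S) = Λ φ' at this
  rw [this]
  exact hΛ φ'

/-- A compact set off `A` is dominated by a bump function vanishing on `A`, whose integrals against
all `p n` are zero. -/
theorem CondenserTheory.VagueTendsto.measure_compl_eq_zero {ι : Type*} {l : Filter ι} [l.NeBot] {p : ι → Measure X}
    {p₀ : Measure X} (h₀ : p₀.Regular) (hv : VagueTendsto (l.map p) p₀) {A : Set X}
    (hA : IsClosed A) (hp : ∀ n, p n Aᶜ = 0) : p₀ Aᶜ = 0 := by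
  rw [hA.isOpen_compl.measure_eq_iSup_isCompact]
  simp only [ENNReal.iSup_eq_zero]
  intro K hKA hK
  obtain ⟨φ, hφ1, hφ0, hφc, hφ01⟩ := exists_continuous_one_zero_of_isCompact hK hA
    (disjoint_left.2 fun x hx hxA => hKA hx hxA)
  have h1 : ∀ n, ∫ x, φ x ∂(p n) = 0 := by
    intro n
    refine integral_eq_zero_of_ae ?_
    have : ∀ᵐ x ∂(p n), x ∈ A := by
      rw [ae_iff]
      exact hp n
    filter_upwards [this] with x hx using hφ0 hx
  have h2 : ∫ x, φ x ∂p₀ = 0 := by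
    have := vagueTendsto_map_iff.1 hv φ φ.continuous hφc
    simp only [h1] at this
    exact tendsto_nhds_unique this tendsto_const_nhds
  have h3 : ∫⁻ x, ENNReal.ofReal (φ x) ∂p₀ = 0 := by
    rw [lintegral_ofReal_of_hasCompactSupport p₀ φ.continuous hφc fun x => (hφ01 x).1, h2,
      ENNReal.ofReal_zero]
  refine le_antisymm ?_ zero_le
  calc p₀ K = ∫⁻ x in K, 1 ∂p₀ := by simp
    _ ≤ ∫⁻ x in K, ENNReal.ofReal (φ x) ∂p₀ := by
        refine setLIntegral_mono_ae' hK.measurableSet (Eventually.of_forall fun x hx => ?_)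
        simp [hφ1 hx]
    _ ≤ ∫⁻ x, ENNReal.ofReal (φ x) ∂p₀ := setLIntegral_le_lintegral _ _
    _ = 0 := h3

variable {κ : X → X → EReal} {k : X × X → ℝ≥0∞} {c : ℝ≥0}

/-- Consistency in real-valued form, tested only against nonnegative `ω`, viewed as the signed
measure `ω - 0`. -/
theorem IsShift.tendsto_energyForm (h : IsShift κ k c) (hpd : PositiveDefinite κ)
    (hcons : Consistent κ) {ι : Type*} {l : Filter ι} [l.NeBot] {p : ι → Measure X}
    {p₀ : Measure X} (h₀ : p₀.Regular) (hp : ∀ n, FiniteEnergyPlus κ (p n)) {M : ℝ}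
    (hM : ∀ n, energyForm κ (p n) (p n) ≤ M) (hv : VagueTendsto (l.map p) p₀) :
    FiniteEnergyPlus κ p₀ ∧ ∀ ω, FiniteEnergyPlus κ ω →
      Tendsto (fun n => energyForm κ (p n) ω) l (𝓝 (energyForm κ p₀ ω)) := by
  obtain ⟨hE, hw⟩ := hcons (l.map p) p₀ M inferInstance h₀ (by
    rw [eventually_map]
    refine Eventually.of_forall fun n => ⟨hp n, ?_⟩
    rw [← h.coe_energyForm hpd (hp n) (hp n)]
    exact_mod_cast hM n) hv
  refine ⟨hE, fun ω hω => ?_⟩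
  let σ : SignedRadon X := ⟨ω, 0, hω.1, inferInstance⟩
  have h1 := hw σ (h.finiteEnergy hpd hω h.finiteEnergyPlus_zero)
  have h2 : ∀ ν, FiniteEnergyPlus κ ν →
      mutualEnergy κ ν σ.pos - mutualEnergy κ ν σ.neg = (energyForm κ ν ω : EReal) := by
    intro ν hν
    change mutualEnergy κ ν ω - mutualEnergy κ ν 0 = _
    rw [← h.coe_energyForm hpd hν hω, ← h.coe_energyForm hpd hν h.finiteEnergyPlus_zero,
      h.energyForm_comm hpd hν h.finiteEnergyPlus_zero, energyForm_zero_left]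
    simp
  rw [tendsto_map'_iff, h2 p₀ hE] at h1
  exact EReal.tendsto_coe.1 (h1.congr fun n => h2 _ (hp n))

/-- If measures `p n` and `q n` carried by disjoint closed sets have bounded masses and energies and
`p n - q n` tends to zero strongly, then both tend to zero vaguely and weakly along every
ultrafilter. -/
theorem IsShift.vagueTendsto_zero (h : IsShift κ k c) (hspd : StrictlyPositiveDefinite κ)
    (hcons : Consistent κ) {ι : Type*} (U : Ultrafilter ι) {p q : ι → Measure X}
    (hp : ∀ n, FiniteEnergyPlus κ (p n)) (hq : ∀ n, FiniteEnergyPlus κ (q n)) {M : ℝ}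
    (hpM : ∀ n, p n univ ≤ ENNReal.ofReal M) (hqM : ∀ n, q n univ ≤ ENNReal.ofReal M)
    {M' : ℝ} (hpE : ∀ n, energyForm κ (p n) (p n) ≤ M') (hqE : ∀ n, energyForm κ (q n) (q n) ≤ M')
    (hlim : Tendsto (fun n => energyForm κ (p n) (p n) + energyForm κ (q n) (q n) -
      2 * energyForm κ (p n) (q n)) U (𝓝 0)) {A B : Set X} (hA : IsClosed A) (hB : IsClosed B)
    (hAB : Disjoint A B) (hpA : ∀ n, p n Aᶜ = 0) (hqB : ∀ n, q n Bᶜ = 0) :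
    (VagueTendsto (Filter.map p U) 0 ∧ VagueTendsto (Filter.map q U) 0) ∧
      ∀ ω, FiniteEnergyPlus κ ω → Tendsto (fun n => energyForm κ (p n) ω) U (𝓝 0) ∧
        Tendsto (fun n => energyForm κ (q n) ω) U (𝓝 0) := by
  have hpd := hspd.1
  obtain ⟨p₀, hp₀, hpv⟩ := exists_vagueTendsto U (fun n => (hp n).1) hpM
  obtain ⟨q₀, hq₀, hqv⟩ := exists_vagueTendsto U (fun n => (hq n).1) hqM
  obtain ⟨hpE₀, hpw⟩ := h.tendsto_energyForm hpd hcons hp₀ hp hpE hpv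
  obtain ⟨hqE₀, hqw⟩ := h.tendsto_energyForm hpd hcons hq₀ hq hqE hqv
  let σ : SignedRadon X := ⟨p₀, q₀, hp₀, hq₀⟩
  have hσ : σ.energy κ = 0 := by
    rw [h.energy_eq hpd (σ := σ) hpE₀ hqE₀]
    have hle := h.two_mul_energyForm_le hpd hpE₀ hqE₀
    -- The right side is the energy of `(p n + q₀) - (q n + p₀)`. Its limit is minus the energy of
    -- `p₀ - q₀`, which is therefore at most zero.
    have hineq : ∀ n, 0 ≤ (energyForm κ (p n) (p n) + energyForm κ (q n) (q n) -
        2 * energyForm κ (p n) (q n)) +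
        2 * (energyForm κ (p n) q₀ + energyForm κ (q n) p₀ - energyForm κ (p n) p₀ -
          energyForm κ (q n) q₀) +
        (energyForm κ p₀ p₀ + energyForm κ q₀ q₀ - 2 * energyForm κ p₀ q₀) := by
      intro n
      have h1 := h.finiteEnergyPlus_add hpd (hp n) hqE₀
      have h2 := h.finiteEnergyPlus_add hpd (hq n) hpE₀
      have h3 := h.two_mul_energyForm_le hpd h1 h2
      rw [h.energyForm_add_left hpd (hp n) hqE₀ h1, h.energyForm_add_left hpd (hp n) hqE₀ h2,
        h.energyForm_add_left hpd (hq n) hpE₀ h2, h.energyForm_add_right hpd (hp n) hqE₀ (hp n),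
        h.energyForm_add_right hpd (hp n) hqE₀ hqE₀, h.energyForm_add_right hpd (hq n) hpE₀ (hp n),
        h.energyForm_add_right hpd (hq n) hpE₀ hqE₀, h.energyForm_add_right hpd (hq n) hpE₀ (hq n),
        h.energyForm_add_right hpd (hq n) hpE₀ hpE₀, h.energyForm_comm hpd hqE₀ (hp n),
        h.energyForm_comm hpd hqE₀ (hq n), h.energyForm_comm hpd hpE₀ (hq n),
        h.energyForm_comm hpd hqE₀ hpE₀] at h3
      linarith
    have hl := (hlim.add (((((hpw q₀ hqE₀).add (hqw p₀ hpE₀)).sub (hpw p₀ hpE₀)).sub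
      (hqw q₀ hqE₀)).const_mul 2)).add_const
        (energyForm κ p₀ p₀ + energyForm κ q₀ q₀ - 2 * energyForm κ p₀ q₀)
    have h0 := ge_of_tendsto' hl hineq
    rw [h.energyForm_comm hpd hqE₀ hpE₀] at h0
    rw [← EReal.coe_zero]
    congr 1
    change energyForm κ p₀ p₀ + energyForm κ q₀ q₀ - 2 * energyForm κ p₀ q₀ = 0
    linarith
  have heq : p₀ = q₀ := hspd.2 σ (h.finiteEnergy hpd hpE₀ hqE₀) hσ
  have hp0 : p₀ = 0 := by
    rw [← Measure.measure_univ_eq_zero]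
    refine measure_mono_null (t := Aᶜ ∪ Bᶜ) (fun x _ => ?_) (measure_union_null
      (hpv.measure_compl_eq_zero hp₀ hA hpA) (heq ▸ hqv.measure_compl_eq_zero hq₀ hB hqB))
    by_contra hx
    rw [mem_union, not_or, notMem_compl_iff, notMem_compl_iff] at hx
    exact disjoint_left.1 hAB hx.1 hx.2
  subst heq
  subst hp0
  refine ⟨⟨hpv, hqv⟩, fun ω hω => ?_⟩
  have h1 := hpw ω hω
  have h2 := hqw ω hω
  rw [energyForm_zero_left] at h1 h2
  exact ⟨h1, h2⟩

end Vague

/-! ## Condensers of infinite capacity -/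

section CondenserLemmas

variable {X : Type*} [TopologicalSpace X] [T2Space X] [LocallyCompactSpace X] [MeasurableSpace X]
  [BorelSpace X] {ι : Type*} {κ : X → X → EReal} {k : X × X → ℝ≥0∞} {c : ℝ≥0}
  {A : Condenser X ι} {a : ι → ℝ} {g : ι → X → ℝ}

theorem CondenserTheory.Condenser.isClosed_biUnion (A : Condenser X ι) (s : Set ι) :
    IsClosed (⋃ i ∈ s, A.plate i) := by
  have hlf : LocallyFinite A.plate := by
    intro x
    obtain ⟨K, hK, hxK⟩ := exists_compact_mem_nhds x
    exact ⟨K, hxK, A.finite_inter K hK⟩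
  have := (hlf.comp_injective (Subtype.val_injective (p := (· ∈ s)))).isClosed_iUnion
    fun i => A.isClosed i
  rwa [iUnion_coe_set] at this

theorem CondenserTheory.Condenser.isClosed_plusSet (A : Condenser X ι) : IsClosed A.plusSet :=
  A.isClosed_biUnion _

theorem CondenserTheory.Condenser.isClosed_minusSet (A : Condenser X ι) : IsClosed A.minusSet :=
  A.isClosed_biUnion _

theorem CondenserTheory.Condenser.disjoint_plusSet_minusSet (A : Condenser X ι) :
    Disjoint A.plusSet A.minusSet := by
  rw [Condenser.plusSet, Condenser.minusSet, disjoint_iUnion₂_left]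
  intro i hi
  rw [disjoint_iUnion₂_right]
  intro j hj
  exact A.disjoint i hi j hj

section R

variable [Countable ι] (μ : A.AssocMeasure)

theorem CondenserTheory.Condenser.AssocMeasure.R_pos_compl : μ.R.pos A.plusSetᶜ = 0 := by
  change Measure.sum (fun i : A.plus => μ.coord i) A.plusSetᶜ = 0
  rw [Measure.sum_apply _ A.isClosed_plusSet.measurableSet.compl, ENNReal.tsum_eq_zero]
  intro i
  exact measure_mono_null (compl_subset_compl.2 (subset_biUnion_of_mem (u := A.plate) i.2))
    (μ.supported i)

theorem CondenserTheory.Condenser.AssocMeasure.R_neg_compl : μ.R.neg A.minusSetᶜ = 0 := by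
  change Measure.sum (fun i : (A.plusᶜ : Set ι) => μ.coord i) A.minusSetᶜ = 0
  rw [Measure.sum_apply _ A.isClosed_minusSet.measurableSet.compl, ENNReal.tsum_eq_zero]
  intro i
  exact measure_mono_null (compl_subset_compl.2 (subset_biUnion_of_mem (u := A.plate) i.2))
    (μ.supported i)

theorem CondenserTheory.Condenser.AssocMeasure.coord_le_R_pos {j : ι} (hj : j ∈ A.plus) :
    μ.coord j ≤ μ.R.pos :=
  Measure.le_sum (fun i : A.plus => μ.coord i) ⟨j, hj⟩

theorem CondenserTheory.Condenser.AssocMeasure.coord_le_R_neg {j : ι} (hj : j ∉ A.plus) :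
    μ.coord j ≤ μ.R.neg :=
  Measure.le_sum (fun i : (A.plusᶜ : Set ι) => μ.coord i) ⟨j, hj⟩

end R

/-- The energy of a difference of two positive measures of finite energy, as a real number. -/
noncomputable def diffEnergy (κ : X → X → EReal) (p q : Measure X) : ℝ :=
  energyForm κ p p + energyForm κ q q - 2 * energyForm κ p q

/-- Infinite capacity means that the infimum of the energies is `0`; as it is not `∞`, admissible
measures exist. -/
theorem IsShift.exists_admissible_of_capacity_eq_top [Countable ι] (h : IsShift κ k c)
    (hpd : PositiveDefinite κ) (hcap : ¬ A.capacity κ a g < ⊤) :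
    ∃ μ : ℕ → A.AssocMeasure, ∀ n, μ n ∈ Condenser.Admissible κ A a g ∧
      diffEnergy κ (μ n).R.pos (μ n).R.neg ≤ 1 / ((n : ℝ) + 1) := by
  rw [not_lt_top_iff, Condenser.capacity, ENNReal.inv_eq_top] at hcap
  have hex : ∀ n : ℕ, ∃ μ : A.AssocMeasure, μ ∈ Condenser.Admissible κ A a g ∧
      diffEnergy κ μ.R.pos μ.R.neg ≤ 1 / ((n : ℝ) + 1) := by
    intro n
    have hpos : (0 : ℝ) < 1 / ((n : ℝ) + 1) := Nat.one_div_pos_of_nat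
    have hlt : (⨅ μ ∈ Condenser.Admissible κ A a g, (μ.R.energy κ).toENNReal) <
        ENNReal.ofReal (1 / ((n : ℝ) + 1)) := by
      rw [hcap]
      exact ENNReal.ofReal_pos.2 hpos
    simp only [iInf_lt_iff] at hlt
    obtain ⟨μ, hμ, hlt⟩ := hlt
    refine ⟨μ, hμ, ?_⟩
    obtain ⟨hp, hq⟩ := h.finiteEnergyPlus_of_finiteEnergy hμ.1
    rw [h.energy_eq hpd hp hq, EReal.toENNReal_of_ne_top (EReal.coe_ne_top _), EReal.toReal_coe,
      ENNReal.ofReal_lt_ofReal_iff hpos] at hlt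
    exact hlt.le
  choose μ hμ using hex
  exact ⟨μ, hμ⟩

theorem IsShift.diffEnergy_nonneg (h : IsShift κ k c) (hpd : PositiveDefinite κ) {p q : Measure X}
    (hp : FiniteEnergyPlus κ p) (hq : FiniteEnergyPlus κ q) : 0 ≤ diffEnergy κ p q := by
  have := h.two_mul_energyForm_le hpd hp hq
  unfold diffEnergy
  linarith

theorem IsShift.tendsto_diffEnergy_zero (h : IsShift κ k c) (hpd : PositiveDefinite κ)
    {p q : ℕ → Measure X} (hp : ∀ n, FiniteEnergyPlus κ (p n))
    (hq : ∀ n, FiniteEnergyPlus κ (q n)) {C : ℝ}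
    (hle : ∀ n, diffEnergy κ (p n) (q n) ≤ C * (1 / ((n : ℝ) + 1))) :
    Tendsto (fun n => diffEnergy κ (p n) (q n)) (hyperfilter ℕ : Ultrafilter ℕ) (𝓝 0) := by
  refine Tendsto.mono_left ?_ Nat.hyperfilter_le_atTop
  have h1 : Tendsto (fun n : ℕ => C * (1 / ((n : ℝ) + 1))) atTop (𝓝 0) := by
    simpa using tendsto_one_div_add_atTop_nhds_zero_nat.const_mul C
  exact squeeze_zero (fun n => h.diffEnergy_nonneg hpd (hp n) (hq n)) hle h1

/-- The nonnegative part `k` of the kernel is bounded on `A⁺ × A⁻`. -/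
theorem IsShift.exists_bound (h : IsShift κ k c)
    (hstanding : A.plus = univ ∨ A.KernelBounded κ) :
    ∃ b : ℝ≥0, ∀ x ∈ A.plusSet, ∀ y ∈ A.minusSet, k (x, y) ≤ b := by
  rcases hstanding with hs | hs
  · refine ⟨0, fun x _ y hy => ?_⟩
    simp [Condenser.minusSet, hs] at hy
  · refine ⟨((⨆ x ∈ A.plusSet, ⨆ y ∈ A.minusSet, κ x y) + ((c : ℝ≥0∞) : EReal)).toENNReal.toNNReal,
      fun x hx y hy => ?_⟩
    rw [ENNReal.coe_toNNReal]
    · have h1 : κ x y ≤ ⨆ x ∈ A.plusSet, ⨆ y ∈ A.minusSet, κ x y :=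
        (le_iSup₂ (f := fun y (_ : y ∈ A.minusSet) => κ x y) y hy).trans
          (le_iSup₂ (f := fun x (_ : x ∈ A.plusSet) => ⨆ y ∈ A.minusSet, κ x y) x hx)
      have h2 : κ x y + ((c : ℝ≥0∞) : EReal) = (k (x, y) : EReal) := by
        rw [h.eq_sub]
        exact EReal.sub_add_cancel (b := (c : ℝ))
      calc k (x, y) = (κ x y + ((c : ℝ≥0∞) : EReal)).toENNReal := by rw [h2, EReal.toENNReal_coe]
        _ ≤ _ := EReal.toENNReal_le_toENNReal (add_le_add_left h1 _)
    · rw [EReal.toENNReal_ne_top_iff]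
      exact (EReal.add_lt_top (ne_of_lt hs) (by simp)).ne

theorem IsShift.energyForm_le_of_bound (h : IsShift κ k c) (hpd : PositiveDefinite κ)
    {p q : Measure X} (hp : FiniteEnergyPlus κ p) (hq : FiniteEnergyPlus κ q) {B C : Set X}
    {b : ℝ≥0} (hb : ∀ x ∈ B, ∀ y ∈ C, k (x, y) ≤ b) (hpB : p Bᶜ = 0) (hqC : q Cᶜ = 0)
    {M : ℝ} (hM : 0 ≤ M) (hpM : p univ ≤ ENNReal.ofReal M) (hqM : q univ ≤ ENNReal.ofReal M) :
    energyForm κ p q ≤ b * M * M := by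
  rw [h.energyForm_eq hpd hp hq]
  refine (sub_le_self _ ENNReal.toReal_nonneg).trans ?_
  refine ENNReal.toReal_le_of_le_ofReal (by positivity) ?_
  have hpB' : ∀ᵐ x ∂p, x ∈ B := hpB
  have hqC' : ∀ᵐ x ∂q, x ∈ C := hqC
  have hin : ∀ x ∈ B, ∫⁻ y, k (x, y) ∂q ≤ b * ENNReal.ofReal M := by
    intro x hx
    calc ∫⁻ y, k (x, y) ∂q ≤ ∫⁻ _, b ∂q :=
          lintegral_mono_ae (hqC'.mono fun y hy => hb x hx y hy)
      _ = b * q univ := lintegral_const _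
      _ ≤ _ := by gcongr
  calc nnEnergy k p q ≤ ∫⁻ _, b * ENNReal.ofReal M ∂p :=
        lintegral_mono_ae (hpB'.mono fun x hx => hin x hx)
    _ = b * ENNReal.ofReal M * p univ := lintegral_const _
    _ ≤ b * ENNReal.ofReal M * ENNReal.ofReal M := by gcongr
    _ = ENNReal.ofReal (b * M * M) := by
        rw [ENNReal.ofReal_mul (by positivity), ENNReal.ofReal_mul (by positivity),
          ENNReal.ofReal_coe_nnreal]

/-- Two strongly asymptotic sequences of bounded mass carried by disjoint closed sets, with a
kernel bounded on the product of these sets, have bounded energies and tend to zero. -/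
theorem IsShift.tendsto_zero_of_bound (h : IsShift κ k c) (hspd : StrictlyPositiveDefinite κ)
    (hcons : Consistent κ) {p q : ℕ → Measure X} (hp : ∀ n, FiniteEnergyPlus κ (p n))
    (hq : ∀ n, FiniteEnergyPlus κ (q n)) {B C : Set X} (hB : IsClosed B) (hC : IsClosed C)
    (hBC : Disjoint B C) {b : ℝ≥0} (hb : ∀ x ∈ B, ∀ y ∈ C, k (x, y) ≤ b)
    (hpB : ∀ n, p n Bᶜ = 0) (hqC : ∀ n, q n Cᶜ = 0) {M : ℝ} (hM : 0 ≤ M)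
    (hpM : ∀ n, p n univ ≤ ENNReal.ofReal M) (hqM : ∀ n, q n univ ≤ ENNReal.ofReal M) {D : ℝ}
    (hD : 0 ≤ D) (hle : ∀ n : ℕ, diffEnergy κ (p n) (q n) ≤ D * (1 / ((n : ℝ) + 1))) :
    (∃ M', ∀ n, energyForm κ (p n) (p n) ≤ M' ∧ energyForm κ (q n) (q n) ≤ M') ∧
      (VagueTendsto (Filter.map p (hyperfilter ℕ : Ultrafilter ℕ)) 0 ∧
        VagueTendsto (Filter.map q (hyperfilter ℕ : Ultrafilter ℕ)) 0) ∧
      ∀ ω, FiniteEnergyPlus κ ω →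
        Tendsto (fun n => energyForm κ (p n) ω) (hyperfilter ℕ : Ultrafilter ℕ) (𝓝 0) ∧
        Tendsto (fun n => energyForm κ (q n) ω) (hyperfilter ℕ : Ultrafilter ℕ) (𝓝 0) := by
  have hpd := hspd.1
  -- The sum of the self-energies is the small difference energy plus twice the bounded cross term;
  -- both summands are nonnegative.
  have hE : ∀ n, energyForm κ (p n) (p n) ≤ D + 2 * (b * M * M) ∧
      energyForm κ (q n) (q n) ≤ D + 2 * (b * M * M) := by
    intro n
    have h1 := hle n
    have h2 := h.energyForm_le_of_bound hpd (hp n) (hq n) hb (hpB n) (hqC n) hM (hpM n) (hqM n)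
    have h3 := h.energyForm_self_nonneg hpd (hp n)
    have h4 := h.energyForm_self_nonneg hpd (hq n)
    have h5 : D * (1 / ((n : ℝ) + 1)) ≤ D :=
      mul_le_of_le_one_right hD (by
        rw [div_le_one (by positivity)]
        linarith [Nat.cast_nonneg (α := ℝ) n])
    unfold diffEnergy at h1
    constructor <;> linarith
  exact ⟨⟨_, hE⟩, h.vagueTendsto_zero hspd hcons (hyperfilter ℕ) hp hq hpM hqM
    (fun n => (hE n).1) (fun n => (hE n).2) (h.tendsto_diffEnergy_zero hpd hp hq hle) hB hC hBC
    hpB hqC⟩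

theorem IsShift.diffEnergy_smul (h : IsShift κ k c) (hpd : PositiveDefinite κ) {p q : Measure X}
    (hp : FiniteEnergyPlus κ p) (hq : FiniteEnergyPlus κ q) {t : ℝ≥0∞} (ht : t ≠ ⊤) :
    diffEnergy κ (t • p) (t • q) = t.toReal ^ 2 * diffEnergy κ p q := by
  unfold diffEnergy
  rw [h.energyForm_smul_smul hpd hp hp ht, h.energyForm_smul_smul hpd hq hq ht,
    h.energyForm_smul_smul hpd hp hq ht]
  ring

/-- A continuous positive weight that is bounded on the plate bounds the mass from below. -/
theorem exists_le_measure_of_bddAbove {ν : Measure X} {B : Set X} (hνB : ν Bᶜ = 0) {f : X → ℝ}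
    {G : ℝ} (hG : ∀ x ∈ B, f x ≤ G) {s : ℝ}
    (hint : ∫⁻ x, ENNReal.ofReal (f x) ∂ν = ENNReal.ofReal s) :
    ENNReal.ofReal s ≤ ENNReal.ofReal G * ν univ := by
  have hB : ∀ᵐ x ∂ν, x ∈ B := hνB
  rw [← hint, ← lintegral_const]
  exact lintegral_mono_ae (hB.mono fun x hx => ENNReal.ofReal_le_ofReal (hG x hx))

theorem IsShift.capacity_lt_top_of_compactSpace [Countable ι] [CompactSpace X]
    (h : IsShift κ k c) (hspd : StrictlyPositiveDefinite κ) (hcons : Consistent κ)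
    (ha : ∀ i, 0 < a i) (hgc : ∀ i, Continuous (g i))
    (hstanding : A.plus = univ ∨ A.KernelBounded κ) (j : ι) : A.capacity κ a g < ⊤ := by
  have hpd := hspd.1
  by_contra hcap
  obtain ⟨μ, hμ⟩ := h.exists_admissible_of_capacity_eq_top hpd hcap
  obtain ⟨b, hb⟩ := h.exists_bound hstanding
  obtain ⟨G, hG⟩ := (isCompact_univ.image (hgc j)).bddAbove
  have hG' : ∀ x, g j x ≤ max G 1 := fun x =>
    (hG (mem_image_of_mem _ (mem_univ x))).trans (le_max_left _ _)
  have hG0 : 0 < max G 1 := lt_of_lt_of_le one_pos (le_max_right _ _)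
  have hE := fun n => h.finiteEnergyPlus_of_finiteEnergy (hμ n).1.1
  -- Total masses need not be bounded above, so both parts are divided by `m n`. The lower bound for
  -- `m n`, from compactness and the constraint on plate `j`, keeps the scaling factors bounded.
  let m : ℕ → ℝ≥0∞ := fun n => (μ n).R.pos univ + (μ n).R.neg univ
  have hr := fun n => (μ n).R.regular_pos
  have hr' := fun n => (μ n).R.regular_neg
  have hm : ∀ n, m n ≠ ⊤ := fun n => ENNReal.add_ne_top.2
    ⟨isCompact_univ.measure_ne_top, isCompact_univ.measure_ne_top⟩
  have hmle : ∀ n, ENNReal.ofReal (a j / max G 1) ≤ m n := by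
    intro n
    rw [ENNReal.ofReal_div_of_pos hG0, ENNReal.div_le_iff' (by simp)
      ENNReal.ofReal_ne_top]
    refine (exists_le_measure_of_bddAbove ((μ n).supported j) (fun x _ => hG' x)
      ((hμ n).1.2 j)).trans ?_
    gcongr
    by_cases hj : j ∈ A.plus
    · exact ((μ n).coord_le_R_pos hj univ).trans le_self_add
    · exact ((μ n).coord_le_R_neg hj univ).trans le_add_self
  have hapos : 0 < a j / max G 1 := div_pos (ha j) hG0
  have hm0 : ∀ n, m n ≠ 0 := fun n h0 => by
    have := hmle n
    rw [h0, nonpos_iff_eq_zero, ENNReal.ofReal_eq_zero] at this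
    linarith
  have ht : ∀ n, (m n)⁻¹ ≠ ⊤ := fun n => ENNReal.inv_ne_top.2 (hm0 n)
  have htle : ∀ n, ((m n)⁻¹).toReal ≤ (a j / max G 1)⁻¹ := by
    intro n
    rw [ENNReal.toReal_inv]
    exact inv_anti₀ hapos ((ENNReal.ofReal_le_iff_le_toReal (hm n)).1 (hmle n))
  obtain ⟨-, ⟨hv, hv'⟩, -⟩ := h.tendsto_zero_of_bound hspd hcons
    (p := fun n => (m n)⁻¹ • (μ n).R.pos) (q := fun n => (m n)⁻¹ • (μ n).R.neg)
    (fun n => h.finiteEnergyPlus_smul (hE n).1 (ht n))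
    (fun n => h.finiteEnergyPlus_smul (hE n).2 (ht n)) A.isClosed_plusSet
    A.isClosed_minusSet A.disjoint_plusSet_minusSet hb
    (fun n => by
      rw [Measure.smul_apply]
      exact (congrArg _ (μ n).R_pos_compl).trans (by simp))
    (fun n => by
      rw [Measure.smul_apply]
      exact (congrArg _ (μ n).R_neg_compl).trans (by simp))
    (M := 1) zero_le_one
    (fun n => by
      rw [Measure.smul_apply, smul_eq_mul, ENNReal.ofReal_one, mul_comm, ← div_eq_mul_inv]
      exact ENNReal.div_le_of_le_mul (by rw [one_mul]; exact le_self_add))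
    (fun n => by
      rw [Measure.smul_apply, smul_eq_mul, ENNReal.ofReal_one, mul_comm, ← div_eq_mul_inv]
      exact ENNReal.div_le_of_le_mul (by rw [one_mul]; exact le_add_self))
    -- Energy scales quadratically, hence the square of the bound on the scaling factor.
    (D := ((a j / max G 1)⁻¹) ^ 2) (by positivity)
    (fun n => by
      rw [h.diffEnergy_smul hpd (hE n).1 (hE n).2 (ht n)]
      have := (hμ n).2
      have h0 := h.diffEnergy_nonneg hpd (hE n).1 (hE n).2
      gcongr
      exact htle n)
  -- On a compact space the constant `1` has compact support, so vague convergence controls total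
  -- mass.
  have hone : ∀ {p : ℕ → Measure X}, VagueTendsto (Filter.map p (hyperfilter ℕ : Ultrafilter ℕ)) 0 →
      Tendsto (fun n => (p n univ).toReal) (hyperfilter ℕ : Ultrafilter ℕ) (𝓝 0) := by
    intro p hp
    have := vagueTendsto_map_iff.1 hp (fun _ => 1) continuous_const
      (HasCompactSupport.of_compactSpace _)
    simpa [Measure.real] using this
  have hsum := (hone hv).add (hone hv')
  have hsum1 : ∀ n, (((m n)⁻¹ • (μ n).R.pos) univ).toReal + (((m n)⁻¹ • (μ n).R.neg) univ).toReal
      = 1 := by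
    intro n
    rw [Measure.smul_apply, Measure.smul_apply, smul_eq_mul, smul_eq_mul, ENNReal.toReal_mul,
      ENNReal.toReal_mul, ← mul_add, ← ENNReal.toReal_add isCompact_univ.measure_ne_top
      isCompact_univ.measure_ne_top, ← ENNReal.toReal_mul, ENNReal.inv_mul_cancel (hm0 n) (hm n),
      ENNReal.toReal_one]
  simp only [hsum1, add_zero] at hsum
  exact one_ne_zero (tendsto_nhds_unique tendsto_const_nhds hsum)

end CondenserLemmas

/-! ## Nonnegative kernels -/

section NonnegKernel

variable {X : Type*} [TopologicalSpace X] [T2Space X] [LocallyCompactSpace X] [MeasurableSpace X]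
  [BorelSpace X] {κ : X → X → EReal} {k : X × X → ℝ≥0∞}

theorem IsShift.mutualEnergy_eq_nnEnergy (h : IsShift κ k 0) {ν μ : Measure X} (hν : ν.Regular)
    (hμ : μ.Regular) : mutualEnergy κ ν μ = (nnEnergy k ν μ : EReal) := by
  rw [h.mutualEnergy_eq hν hμ]
  simp

theorem IsShift.energyForm_eq_toReal (h : IsShift κ k 0) {ν μ : Measure X} (hν : ν.Regular)
    (hμ : μ.Regular) : energyForm κ ν μ = (nnEnergy k ν μ).toReal := by
  rw [energyForm, h.mutualEnergy_eq_nnEnergy hν hμ]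
  simp

theorem IsShift.energyForm_mono (h : IsShift κ k 0) (hpd : PositiveDefinite κ)
    {ν ν' μ μ' : Measure X} (hν : ν.Regular) (hμ : μ.Regular) (hν' : FiniteEnergyPlus κ ν')
    (hμ' : FiniteEnergyPlus κ μ') (hle : ν ≤ ν') (hle' : μ ≤ μ') :
    energyForm κ ν μ ≤ energyForm κ ν' μ' := by
  rw [h.energyForm_eq_toReal hν hμ, h.energyForm_eq_toReal hν'.1 hμ'.1]
  exact ENNReal.toReal_mono (h.nnEnergy_ne_top hpd hν' hμ')
    ((nnEnergy_mono_left hle).trans (nnEnergy_mono_right hle'))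

/-- The normalised restriction of a measure of finite energy to a compact set competes for the
interior capacity. -/
theorem IsShift.iInf_mul_le_nnEnergy (h : IsShift κ k 0) {ν : Measure X} (hν : ν.Regular)
    {E K : Set X} (hK : IsCompact K) (hKE : K ⊆ E) (hK0 : ν K ≠ 0) :
    (⨅ (τ : Measure X) (_ : τ.Regular ∧ τ univ = 1 ∧ ∃ K : Set X, IsCompact K ∧ K ⊆ E ∧ τ Kᶜ = 0),
      (mutualEnergy κ τ τ).toENNReal) ≤ (ν K)⁻¹ * ((ν K)⁻¹ * nnEnergy k ν ν) := by
  have hKt : ν K ≠ ⊤ := hK.measure_ne_top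
  have ht : (ν K)⁻¹ ≠ ⊤ := ENNReal.inv_ne_top.2 hK0
  have hr : (ν.restrict K).Regular := Measure.Regular.restrict_of_measure_ne_top hKt
  have hr' : ((ν K)⁻¹ • ν.restrict K).Regular := Measure.Regular.smul ht
  have hτ : ((ν K)⁻¹ • ν.restrict K).Regular ∧ ((ν K)⁻¹ • ν.restrict K) univ = 1 ∧
      ∃ K' : Set X, IsCompact K' ∧ K' ⊆ E ∧ ((ν K)⁻¹ • ν.restrict K) K'ᶜ = 0 :=
    ⟨hr', by simp [ENNReal.inv_mul_cancel hK0 hKt], K, hK, hKE, by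
      simp [Measure.restrict_apply hK.measurableSet.compl]⟩
  refine le_trans (iInf₂_le ((ν K)⁻¹ • ν.restrict K) hτ) ?_
  rw [h.mutualEnergy_eq_nnEnergy hr' hr', EReal.toENNReal_coe, nnEnergy_smul_left,
    h.nnEnergy_comm hr hr', nnEnergy_smul_left]
  gcongr
  exact (nnEnergy_mono_left Measure.restrict_le_self).trans
    (nnEnergy_mono_right Measure.restrict_le_self)

/-- A property that holds nearly everywhere holds almost everywhere with respect to measures of
finite energy. -/
theorem IsShift.measure_eq_zero_of_nearlyEverywhere (h : IsShift κ k 0) {ν : Measure X}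
    (hν : FiniteEnergyPlus κ ν) {E : Set X} {P : X → Prop} (hne : NearlyEverywhere κ E P)
    {N : Set X} (hN : MeasurableSet N) (hNE : N ⊆ {x ∈ E | ¬ P x}) {f : X → ℝ≥0∞}
    (hf : Measurable f) (hf0 : ∀ x, f x ≠ 0) (hfi : ∫⁻ x, f x ∂ν ≠ ⊤) : ν N = 0 := by
  have hr := hν.1
  have hcompact : ∀ K ⊆ N, IsCompact K → ν K = 0 := by
    intro K hKN hK
    by_contra hK0
    have h1 := h.iInf_mul_le_nnEnergy hr hK (hKN.trans hNE) hK0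
    rw [NearlyEverywhere, interiorCapacity, ENNReal.inv_eq_zero] at hne
    rw [hne, top_le_iff] at h1
    have ht : (ν K)⁻¹ ≠ ⊤ := ENNReal.inv_ne_top.2 hK0
    exact ENNReal.mul_ne_top ht (ENNReal.mul_ne_top ht (h.finiteEnergyPlus_iff.1 hν).2) h1
  -- Inner regularity on Borel sets requires finite measure. The integrable, nowhere zero `f`
  -- supplies by Markov's inequality a countable cover by sets of finite measure.
  have hcover : N ⊆ ⋃ n : ℕ, N ∩ {x | ((n : ℝ≥0∞) + 1)⁻¹ ≤ f x} := by
    intro x hx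
    obtain ⟨n, hn⟩ := ENNReal.exists_inv_nat_lt (hf0 x)
    refine mem_iUnion.2 ⟨n, hx, le_trans ?_ hn.le⟩
    exact ENNReal.inv_le_inv.2 le_self_add
  refine measure_mono_null hcover (measure_iUnion_null fun n => ?_)
  have hpos : ((n : ℝ≥0∞) + 1)⁻¹ ≠ 0 := by simp
  have hlt : ((n : ℝ≥0∞) + 1)⁻¹ ≠ ⊤ := by simp
  have hfin : ν (N ∩ {x | ((n : ℝ≥0∞) + 1)⁻¹ ≤ f x}) ≠ ⊤ := by
    refine ne_top_of_le_ne_top (ENNReal.div_ne_top hfi hpos) ((measure_mono inter_subset_right).trans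
      (meas_ge_le_lintegral_div hf.aemeasurable hpos hlt))
  rw [(hN.inter (measurableSet_le measurable_const hf)).measure_eq_iSup_isCompact_of_ne_top hfin]
  simp only [ENNReal.iSup_eq_zero]
  exact fun K hK hKc => hcompact K (hK.trans inter_subset_left) hKc

/-- On a closed set of finite interior capacity, the energy is bounded below in terms of the
mass. -/
theorem IsShift.exists_le_energyForm_of_interiorCapacity (h : IsShift κ k 0) {B : Set X}
    (hB : IsClosed B) (hcap : interiorCapacity κ B < ⊤) {s : ℝ} (hs : 0 < s) :
    ∃ δ : ℝ, 0 < δ ∧ ∀ ν, FiniteEnergyPlus κ ν → ν Bᶜ = 0 → ENNReal.ofReal s ≤ ν univ →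
      δ ≤ energyForm κ ν ν := by
  rw [interiorCapacity, lt_top_iff_ne_top, ENNReal.inv_ne_top] at hcap
  obtain ⟨w, hw0, hw⟩ : ∃ w : ℝ, 0 < w ∧ ENNReal.ofReal w ≤ ⨅ (τ : Measure X) (_ : τ.Regular ∧
      τ univ = 1 ∧ ∃ K : Set X, IsCompact K ∧ K ⊆ B ∧ τ Kᶜ = 0),
      (mutualEnergy κ τ τ).toENNReal := by
    obtain ⟨w, hw0, hw⟩ := ENNReal.lt_iff_exists_nnreal_btwn.1 (pos_iff_ne_zero.2 hcap)
    refine ⟨w, by exact_mod_cast hw0, ?_⟩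
    rw [ENNReal.ofReal_coe_nnreal]
    exact hw.le
  -- Competitors for the capacity have compact support: some compact set carries mass more than `s /
  -- 2`, and normalising there costs the square of the mass.
  refine ⟨w * (s / 2) ^ 2, by positivity, fun ν hν hνB hsν => ?_⟩
  have hr := hν.1
  have hlt : ENNReal.ofReal (s / 2) < ν univ :=
    lt_of_lt_of_le ((ENNReal.ofReal_lt_ofReal_iff hs).2 (by linarith)) hsν
  obtain ⟨K, -, hK, hKs⟩ := isOpen_univ.exists_lt_isCompact hlt
  have hKB : ν (K ∩ B) = ν K := by
    refine le_antisymm (measure_mono inter_subset_left) ?_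
    calc ν K ≤ ν (K ∩ B ∪ Bᶜ) := measure_mono fun x hx => by
          by_cases hxB : x ∈ B
          exacts [Or.inl ⟨hx, hxB⟩, Or.inr hxB]
      _ ≤ ν (K ∩ B) + ν Bᶜ := measure_union_le _ _
      _ = ν (K ∩ B) := by rw [hνB, add_zero]
  have hKB0 : ν (K ∩ B) ≠ 0 := by
    rw [hKB]
    exact (lt_of_le_of_lt zero_le hKs).ne'
  have h1 := hw.trans (h.iInf_mul_le_nnEnergy hr (hK.inter_right hB) inter_subset_right hKB0)
  rw [hKB] at h1 hKB0
  have hKt : ν K ≠ ⊤ := hK.measure_ne_top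
  rw [h.energyForm_eq_toReal hr hr]
  refine (ENNReal.ofReal_le_iff_le_toReal (h.finiteEnergyPlus_iff.1 hν).2).1 ?_
  rw [ENNReal.ofReal_mul hw0.le, ENNReal.ofReal_pow (by positivity)]
  calc ENNReal.ofReal w * ENNReal.ofReal (s / 2) ^ 2
      ≤ ((ν K)⁻¹ * ((ν K)⁻¹ * nnEnergy k ν ν)) * (ν K) ^ 2 := by gcongr
    _ = ((ν K)⁻¹ * ν K) * ((ν K)⁻¹ * ν K) * nnEnergy k ν ν := by ring
    _ = nnEnergy k ν ν := by simp [ENNReal.inv_mul_cancel hKB0 hKt]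

/-- Truncation at height `T`: above it, `t = t ^ (-(r - 1)) * t ^ r` and the first factor is at most
its value at `T`. A bound on the integral of `g ^ r` thus makes the tail of `g` uniformly small. -/
theorem Real.le_add_rpow_mul_rpow {T t r : ℝ} (hT : 0 < T) (ht : 0 < t) (hr : 1 < r) :
    t ≤ T + T ^ (-(r - 1)) * t ^ r := by
  rcases le_total t T with h | h
  · have : 0 ≤ T ^ (-(r - 1)) * t ^ r := by positivity
    linarith
  · calc t = t ^ (-(r - 1)) * t ^ r := by
          rw [← Real.rpow_add ht]
          ring_nf
          rw [Real.rpow_one]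
      _ ≤ T ^ (-(r - 1)) * t ^ r := by
          gcongr ?_ * _
          exact Real.rpow_le_rpow_of_nonpos hT h (by linarith)
      _ ≤ _ := by linarith

/-- The integral of a power of the weight is bounded under the growth condition. -/
theorem IsShift.lintegral_rpow_le (h : IsShift κ k 0) {ι : Type*} {A : Condenser X ι}
    {g : ι → X → ℝ} (hgc : ∀ i, Continuous (g i)) (hgpos : ∀ i x, 0 < g i x) {j : ι} {r : ℝ}
    {ω : SignedRadon X} (hne : NearlyEverywhere κ (A.plate j)
      fun x => ω.PotentialDefined κ x ∧ ((g j x ^ r : ℝ) : EReal) ≤ ω.pot κ x)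
    {ν : Measure X} (hν : FiniteEnergyPlus κ ν) (hνA : ν (A.plate j)ᶜ = 0)
    (hint : ∫⁻ x, ENNReal.ofReal (g j x) ∂ν ≠ ⊤) :
    ∫⁻ x, ENNReal.ofReal (g j x ^ r) ∂ν ≤ nnEnergy k ν ω.pos := by
  have hωr := ω.regular_pos
  have hωr' := ω.regular_neg
  have hlsc := lowerSemicontinuous_lintegral ω.pos h.lsc
  have hgr : Continuous fun x => g j x ^ r :=
    (hgc j).rpow_const fun x => Or.inl (hgpos j x).ne'
  -- The exceptional set of the growth condition may be nonmeasurable. As `κ ≥ 0`, the negative part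
  -- of `ω` can be dropped; the set where this weaker bound fails is Borel and lies in the
  -- exceptional set.
  have hmeas : MeasurableSet (A.plate j ∩
      {x | ∫⁻ y, k (x, y) ∂ω.pos < ENNReal.ofReal (g j x ^ r)}) :=
    (A.isClosed j).measurableSet.inter (measurableSet_lt hlsc.measurable
      (ENNReal.continuous_ofReal.comp hgr).measurable)
  have hsub : A.plate j ∩ {x | ∫⁻ y, k (x, y) ∂ω.pos < ENNReal.ofReal (g j x ^ r)} ⊆
      {x ∈ A.plate j | ¬ (ω.PotentialDefined κ x ∧ ((g j x ^ r : ℝ) : EReal) ≤ ω.pot κ x)} := by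
    rintro x ⟨hxA, hx⟩
    refine ⟨hxA, fun hP => not_le.2 (mem_ofPred.1 hx) ?_⟩
    have h1 := hP.2
    rw [SignedRadon.pot, h.potential_eq, h.potential_eq] at h1
    simp only [ENNReal.coe_zero, zero_mul, EReal.coe_ennreal_zero, sub_zero] at h1
    have h2 : ((g j x ^ r : ℝ) : EReal) ≤ ((∫⁻ y, k (x, y) ∂ω.pos : ℝ≥0∞) : EReal) := by
      refine h1.trans ?_
      rw [sub_eq_add_neg]
      refine (add_le_add_right (EReal.neg_le_zero.2 (EReal.coe_ennreal_nonneg _)) _).trans ?_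
      rw [add_zero]
    have h3 := EReal.toENNReal_le_toENNReal h2
    rwa [EReal.toENNReal_coe, EReal.toENNReal_of_ne_top (EReal.coe_ne_top _),
      EReal.toReal_coe] at h3
  have hzero := h.measure_eq_zero_of_nearlyEverywhere hν hne hmeas hsub
    (ENNReal.continuous_ofReal.comp (hgc j)).measurable
    (fun x => by simpa using hgpos j x) hint
  refine lintegral_mono_ae ?_
  have hA : ∀ᵐ x ∂ν, x ∈ A.plate j := hνA
  have hN : ∀ᵐ x ∂ν, x ∉ A.plate j ∩
      {x | ∫⁻ y, k (x, y) ∂ω.pos < ENNReal.ofReal (g j x ^ r)} := measure_eq_zero_iff_ae_notMem.1 hzero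
  filter_upwards [hA, hN] with x hxA hxN
  by_contra hcon
  exact hxN ⟨hxA, not_le.1 hcon⟩

/-- Measures of bounded energy on a plate with prescribed weighted mass have mass bounded from
below. -/
theorem IsShift.exists_le_measure_univ (h : IsShift κ k 0) (hpd : PositiveDefinite κ)
    {ι : Type*} {A : Condenser X ι}
    {g : ι → X → ℝ} (hgc : ∀ i, Continuous (g i)) (hgpos : ∀ i x, 0 < g i x) {j : ι}
    (hgrowth : BddAbove (g j '' A.plate j) ∨ A.Growth κ g j) {s : ℝ} (hs : 0 < s) (M : ℝ) :
    ∃ s' : ℝ, 0 < s' ∧ ∀ ν, FiniteEnergyPlus κ ν → ν (A.plate j)ᶜ = 0 →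
      ∫⁻ x, ENNReal.ofReal (g j x) ∂ν = ENNReal.ofReal s → energyForm κ ν ν ≤ M →
      ENNReal.ofReal s' ≤ ν univ := by
  rcases hgrowth with ⟨G, hG⟩ | ⟨r, hr, ω, hω, hne⟩
  · have hG0 : 0 < max G 1 := lt_of_lt_of_le one_pos (le_max_right _ _)
    refine ⟨s / max G 1, by positivity, fun ν hν hνA hint _ => ?_⟩
    rw [ENNReal.ofReal_div_of_pos hG0, ENNReal.div_le_iff' (by simp) ENNReal.ofReal_ne_top]
    exact exists_le_measure_of_bddAbove hνA
      (fun x hx => (hG (mem_image_of_mem _ hx)).trans (le_max_left _ _)) hint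
  · have hω' := (h.finiteEnergyPlus_of_finiteEnergy hω).1
    let Q : ℝ := |M| + energyForm κ ω.pos ω.pos
    have hQ : 0 ≤ Q := add_nonneg (abs_nonneg _) (h.energyForm_self_nonneg hpd hω')
    -- `Q` bounds the integral of `g ^ r`, so this `T` makes the tail less than `s / 2`. The
    -- remaining weighted mass `s / 2` is at most `T` times the mass.
    obtain ⟨T, hTs, hT⟩ : ∃ T : ℝ, T ^ (-(r - 1)) * Q < s / 2 ∧ 0 < T := by
      have h1 := (tendsto_rpow_neg_atTop (show 0 < r - 1 by linarith)).mul_const Q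
      rw [zero_mul] at h1
      exact ((h1.eventually_lt_const (half_pos hs)).and (eventually_gt_atTop 0)).exists
    refine ⟨s / 2 / T, by positivity, fun ν hν hνA hint hM => ?_⟩
    have h1 := h.lintegral_rpow_le hgc hgpos hne hν hνA (by simp [hint])
    have h2 : nnEnergy k ν ω.pos ≤ ENNReal.ofReal Q := by
      rw [← ENNReal.ofReal_toReal (h.nnEnergy_ne_top hpd hν hω'),
        ← h.energyForm_eq_toReal hν.1 hω'.1]
      refine ENNReal.ofReal_le_ofReal ?_
      have h3 := h.two_mul_energyForm_le hpd hν hω'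
      have h4 := le_abs_self M
      have h5 := h.energyForm_self_nonneg hpd hω'
      have h6 := h.energyForm_self_nonneg hpd hν
      change _ ≤ |M| + energyForm κ ω.pos ω.pos
      linarith
    have h3 : ENNReal.ofReal s ≤ ENNReal.ofReal T * ν univ + ENNReal.ofReal (s / 2) := by
      rw [← hint]
      calc ∫⁻ x, ENNReal.ofReal (g j x) ∂ν
          ≤ ∫⁻ x, (ENNReal.ofReal T +
              ENNReal.ofReal (T ^ (-(r - 1))) * ENNReal.ofReal (g j x ^ r)) ∂ν := by
            refine lintegral_mono fun x => ?_
            have hgx := hgpos j x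
            rw [← ENNReal.ofReal_mul (by positivity), ← ENNReal.ofReal_add hT.le (by positivity)]
            exact ENNReal.ofReal_le_ofReal (Real.le_add_rpow_mul_rpow hT hgx hr)
        _ = ENNReal.ofReal T * ν univ +
              ENNReal.ofReal (T ^ (-(r - 1))) * ∫⁻ x, ENNReal.ofReal (g j x ^ r) ∂ν := by
            rw [lintegral_add_left measurable_const, lintegral_const,
              lintegral_const_mul' _ _ ENNReal.ofReal_ne_top]
        _ ≤ ENNReal.ofReal T * ν univ +
              ENNReal.ofReal (T ^ (-(r - 1))) * ENNReal.ofReal Q := by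
            gcongr
            exact h1.trans h2
        _ ≤ _ := by
            rw [← ENNReal.ofReal_mul (by positivity)]
            gcongr
    rw [ENNReal.ofReal_div_of_pos hT, ENNReal.div_le_iff' (by simpa using hT)
      ENNReal.ofReal_ne_top]
    have h4 : ENNReal.ofReal s = ENNReal.ofReal (s / 2) + ENNReal.ofReal (s / 2) := by
      rw [← ENNReal.ofReal_add (by positivity) (by positivity), add_halves]
    rw [h4] at h3
    exact ENNReal.le_of_add_le_add_right ENNReal.ofReal_ne_top h3

/-- A weakly null sequence of bounded energy cannot stay in a convex set on which the energy is
bounded away from zero. -/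
theorem IsShift.false_of_weakly_null {c : ℝ≥0} (h : IsShift κ k c) (hpd : PositiveDefinite κ)
    {B : Set X} {s δ : ℝ} (hδ : 0 < δ)
    (hle : ∀ ν, FiniteEnergyPlus κ ν → ν Bᶜ = 0 → ENNReal.ofReal s ≤ ν univ →
      δ ≤ energyForm κ ν ν) (U : Ultrafilter ℕ) {x : ℕ → Measure X}
    (hx : ∀ n, FiniteEnergyPlus κ (x n)) (hxB : ∀ n, x n Bᶜ = 0)
    (hxs : ∀ n, ENNReal.ofReal s ≤ x n univ) {M : ℝ} (hM : ∀ n, energyForm κ (x n) (x n) ≤ M)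
    (hweak : ∀ ω, FiniteEnergyPlus κ ω → Tendsto (fun n => energyForm κ (x n) ω) U (𝓝 0)) :
    False := by
  let D : Set ℝ := {e | ∃ ν, FiniteEnergyPlus κ ν ∧ ν Bᶜ = 0 ∧ ENNReal.ofReal s ≤ ν univ ∧
    e = energyForm κ ν ν}
  have hDbdd : BddBelow D := ⟨δ, by
    rintro e ⟨ν, hν, hνB, hνs, rfl⟩
    exact hle ν hν hνB hνs⟩
  have hDne : D.Nonempty := ⟨_, x 0, hx 0, hxB 0, hxs 0, rfl⟩
  let e := sInf D
  have he : δ ≤ e := le_csInf hDne (by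
    rintro e ⟨ν, hν, hνB, hνs, rfl⟩
    exact hle ν hν hνB hνs)
  have he0 : 0 < e := hδ.trans_le he
  have hM0 : 0 < M := lt_of_lt_of_le hδ ((hle _ (hx 0) (hxB 0) (hxs 0)).trans (hM 0))
  -- These weights minimise `u ^ 2 * e + t ^ 2 * M` subject to `u + t = 1`; the minimum is `e * u`,
  -- strictly below `e`.
  let t : ℝ := e / (e + M)
  let u : ℝ := M / (e + M)
  have ht : 0 < t := by positivity
  have hu : 0 < u := by positivity
  have htu : u + t = 1 := by
    simp only [t, u]
    field_simp
    ring
  -- The convex combination of `ν` and `x n` stays in the set, and weak nullity removes the cross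
  -- term in the limit.
  have hcomb : ∀ ν, FiniteEnergyPlus κ ν → ν Bᶜ = 0 → ENNReal.ofReal s ≤ ν univ →
      e ≤ u ^ 2 * energyForm κ ν ν + t ^ 2 * M := by
    intro ν hν hνB hνs
    have hn : ∀ n, e ≤ u ^ 2 * energyForm κ ν ν + t ^ 2 * M +
        2 * u * t * energyForm κ (x n) ν := by
      intro n
      have h1 := h.finiteEnergyPlus_smul hν (ENNReal.ofReal_ne_top (r := u))
      have h2 := h.finiteEnergyPlus_smul (hx n) (ENNReal.ofReal_ne_top (r := t))
      have h3 := h.finiteEnergyPlus_add hpd h1 h2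
      have h4 : e ≤ energyForm κ (ENNReal.ofReal u • ν + ENNReal.ofReal t • x n)
          (ENNReal.ofReal u • ν + ENNReal.ofReal t • x n) := by
        refine csInf_le hDbdd ⟨_, h3, by simp [hνB, hxB n], ?_, rfl⟩
        calc ENNReal.ofReal s = ENNReal.ofReal u * ENNReal.ofReal s +
              ENNReal.ofReal t * ENNReal.ofReal s := by
              rw [← add_mul, ← ENNReal.ofReal_add hu.le ht.le, htu, ENNReal.ofReal_one, one_mul]
          _ ≤ ENNReal.ofReal u * ν univ + ENNReal.ofReal t * x n univ := by
              gcongr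
              exact hxs n
          _ = _ := by simp
      rw [h.energyForm_add_left hpd h1 h2 h3, h.energyForm_add_right hpd h1 h2 h1,
        h.energyForm_add_right hpd h1 h2 h2, h.energyForm_comm hpd h1 h2,
        h.energyForm_smul_smul hpd hν hν ENNReal.ofReal_ne_top,
        h.energyForm_smul_smul hpd (hx n) (hx n) ENNReal.ofReal_ne_top,
        h.energyForm_smul_right hpd hν h2 ENNReal.ofReal_ne_top,
        h.energyForm_smul_left hpd (hx n) hν ENNReal.ofReal_ne_top,
        ENNReal.toReal_ofReal hu.le, ENNReal.toReal_ofReal ht.le] at h4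
      have h5 : t ^ 2 * energyForm κ (x n) (x n) ≤ t ^ 2 * M := by
        gcongr
        exact hM n
      linarith
    have hlim := ((hweak ν hν).const_mul (2 * u * t)).const_add
      (u ^ 2 * energyForm κ ν ν + t ^ 2 * M)
    rw [mul_zero, add_zero] at hlim
    exact ge_of_tendsto' hlim hn
  have hfin : (e - t ^ 2 * M) / u ^ 2 ≤ e := le_csInf hDne (by
    rintro _ ⟨ν, hν, hνB, hνs, rfl⟩
    rw [div_le_iff₀ (by positivity)]
    linarith [hcomb ν hν hνB hνs])
  rw [div_le_iff₀ (by positivity)] at hfin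
  have hval : e * u ^ 2 + t ^ 2 * M = e * u := by
    simp only [t, u]
    field_simp
    ring
  have : e * u < e := by
    have : u < 1 := by linarith
    nlinarith
  linarith

/-! ### The contradiction on a noncompact space -/

section NonCompact

variable {ι : Type*} [Countable ι] {A : Condenser X ι} {a : ι → ℝ} {g : ι → X → ℝ}

/-- The coordinates of admissible measures have uniformly summable masses. -/
theorem CondenserTheory.Condenser.tsum_coord_le (ha : ∀ i, 0 < a i)
    (μ : A.AssocMeasure)
    (hint : ∀ i, ∫⁻ x, ENNReal.ofReal (g i x) ∂(μ.coord i) = ENNReal.ofReal (a i)) :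
    ∑' i, μ.coord i univ ≤
      ∑' i, ENNReal.ofReal (a i) / (⨅ x ∈ A.plate i, ENNReal.ofReal (g i x)) := by
  refine ENNReal.tsum_le_tsum fun i => ?_
  rw [ENNReal.le_div_iff_mul_le (Or.inr (by simpa using ha i)) (Or.inr ENNReal.ofReal_ne_top),
    mul_comm, ← hint i, ← lintegral_const]
  have hA : ∀ᵐ x ∂(μ.coord i), x ∈ A.plate i := μ.supported i
  exact lintegral_mono_ae (hA.mono fun x hx => iInf₂_le x hx)

theorem IsShift.capacity_lt_top_of_nonneg (h : IsShift κ k 0) (hspd : StrictlyPositiveDefinite κ)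
    (hcons : Consistent κ) (ha : ∀ i, 0 < a i) (hgc : ∀ i, Continuous (g i))
    (hgpos : ∀ i x, 0 < g i x)
    (hstanding : A.plus = univ ∨ (A.SummableCondition a g ∧ A.KernelBounded κ)) {j : ι}
    (hgrowth : BddAbove (g j '' A.plate j) ∨ A.Growth κ g j)
    (hj : interiorCapacity κ (A.plate j) < ⊤) : A.capacity κ a g < ⊤ := by
  have hpd := hspd.1
  by_contra hcap
  obtain ⟨μ, hμ⟩ := h.exists_admissible_of_capacity_eq_top hpd hcap
  have hE := fun n => h.finiteEnergyPlus_of_finiteEnergy (hμ n).1.1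
  rcases hstanding with hplus | ⟨hsum, hbd⟩
  · have hneg : ∀ n, (μ n).R.neg = 0 := by
      intro n
      have h1 := (μ n).R_neg_compl
      have h2 : A.minusSet = ∅ := by simp [Condenser.minusSet, hplus]
      rw [h2, compl_empty] at h1
      exact Measure.measure_univ_eq_zero.1 h1
    have hjp : j ∈ A.plus := hplus ▸ mem_univ j
    -- Without negative plates the energy of the whole tends to zero, and with a nonnegative kernel
    -- it dominates that of each coordinate.
    have hle : ∀ n, energyForm κ ((μ n).coord j) ((μ n).coord j) ≤ 1 / ((n : ℝ) + 1) := by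
      intro n
      have h1 := (hμ n).2
      rw [hneg n, diffEnergy, h.energyForm_comm hpd (hE n).1 h.finiteEnergyPlus_zero,
        energyForm_zero_left, energyForm_zero_left] at h1
      have h2 := h.energyForm_mono hpd ((μ n).regular j) ((μ n).regular j) (hE n).1 (hE n).1
        ((μ n).coord_le_R_pos hjp) ((μ n).coord_le_R_pos hjp)
      linarith
    obtain ⟨s, hs, hmass⟩ := h.exists_le_measure_univ hpd hgc hgpos hgrowth (ha j) 1
    obtain ⟨δ, hδ, henergy⟩ :=
      h.exists_le_energyForm_of_interiorCapacity (A.isClosed j) hj hs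
    obtain ⟨n, hn⟩ := exists_nat_one_div_lt hδ
    have hEj := h.finiteEnergyPlus_of_le (hE n).1 ((μ n).regular j) ((μ n).coord_le_R_pos hjp)
    have h1 : 1 / ((n : ℝ) + 1) ≤ 1 := by
      rw [div_le_one (by positivity)]
      linarith [Nat.cast_nonneg (α := ℝ) n]
    have h2 := henergy _ hEj ((μ n).supported j)
      (hmass _ hEj ((μ n).supported j) ((hμ n).1.2 j) ((hle n).trans h1))
    linarith [hle n]
  · obtain ⟨b, hb⟩ := h.exists_bound (A := A) (Or.inr hbd)
    let S : ℝ≥0∞ := ∑' i, ENNReal.ofReal (a i) / (⨅ x ∈ A.plate i, ENNReal.ofReal (g i x))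
    have hS : S ≠ ⊤ := ne_of_lt hsum
    have hmass : ∀ n, ∑' i, (μ n).coord i univ ≤ ENNReal.ofReal S.toReal := by
      intro n
      rw [ENNReal.ofReal_toReal hS]
      exact Condenser.tsum_coord_le ha (μ n) (hμ n).1.2
    have hpm : ∀ n, (μ n).R.pos univ ≤ ENNReal.ofReal S.toReal := by
      intro n
      refine le_trans ?_ (hmass n)
      change Measure.sum (fun i : A.plus => (μ n).coord i) univ ≤ _
      rw [Measure.sum_apply _ MeasurableSet.univ]
      exact ENNReal.tsum_comp_le_tsum_of_injective Subtype.val_injective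
        fun i => (μ n).coord i univ
    have hqm : ∀ n, (μ n).R.neg univ ≤ ENNReal.ofReal S.toReal := by
      intro n
      refine le_trans ?_ (hmass n)
      change Measure.sum (fun i : (A.plusᶜ : Set ι) => (μ n).coord i) univ ≤ _
      rw [Measure.sum_apply _ MeasurableSet.univ]
      exact ENNReal.tsum_comp_le_tsum_of_injective Subtype.val_injective
        fun i => (μ n).coord i univ
    obtain ⟨⟨M, hM⟩, -, hweak⟩ := h.tendsto_zero_of_bound hspd hcons (fun n => (hE n).1)
      (fun n => (hE n).2) A.isClosed_plusSet A.isClosed_minusSet A.disjoint_plusSet_minusSet hb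
      (fun n => (μ n).R_pos_compl) (fun n => (μ n).R_neg_compl) ENNReal.toReal_nonneg hpm hqm
      (D := 1) zero_le_one (fun n => by simpa using (hμ n).2)
    obtain ⟨s, hs, hmass⟩ := h.exists_le_measure_univ hpd hgc hgpos hgrowth (ha j) M
    obtain ⟨δ, hδ, henergy⟩ :=
      h.exists_le_energyForm_of_interiorCapacity (A.isClosed j) hj hs
    -- `P` is the part of `R` with the sign of plate `j`; it dominates the `j`-th coordinate, which
    -- thus inherits bounded energy and, by squeezing between `0` and `P`, weak convergence to zero.
    obtain ⟨P, hP, hle, hPM, hPw⟩ : ∃ P : ℕ → Measure X, (∀ n, FiniteEnergyPlus κ (P n)) ∧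
        (∀ n, (μ n).coord j ≤ P n) ∧ (∀ n, energyForm κ (P n) (P n) ≤ M) ∧
        ∀ ω, FiniteEnergyPlus κ ω →
          Tendsto (fun n => energyForm κ (P n) ω) (hyperfilter ℕ : Ultrafilter ℕ) (𝓝 0) := by
      by_cases hjp : j ∈ A.plus
      · exact ⟨fun n => (μ n).R.pos, fun n => (hE n).1, fun n => (μ n).coord_le_R_pos hjp,
          fun n => (hM n).1, fun ω hω => (hweak ω hω).1⟩
      · exact ⟨fun n => (μ n).R.neg, fun n => (hE n).2, fun n => (μ n).coord_le_R_neg hjp,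
          fun n => (hM n).2, fun ω hω => (hweak ω hω).2⟩
    have hEj := fun n => h.finiteEnergyPlus_of_le (hP n) ((μ n).regular j) (hle n)
    have hEM : ∀ n, energyForm κ ((μ n).coord j) ((μ n).coord j) ≤ M := fun n =>
      (h.energyForm_mono hpd ((μ n).regular j) ((μ n).regular j) (hP n) (hP n) (hle n)
        (hle n)).trans (hPM n)
    refine h.false_of_weakly_null hpd hδ henergy (hyperfilter ℕ) hEj (fun n => (μ n).supported j)
      (fun n => hmass _ (hEj n) ((μ n).supported j) ((hμ n).1.2 j) (hEM n)) hEM fun ω hω => ?_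
    refine squeeze_zero (fun n => ?_) (fun n => ?_) (hPw ω hω)
    · rw [h.energyForm_eq_toReal ((μ n).regular j) hω.1]
      exact ENNReal.toReal_nonneg
    · exact h.energyForm_mono hpd ((μ n).regular j) hω.1 (hP n) hω (hle n) le_rfl

end NonCompact

end NonnegKernel

theorem mainTheorem7 {X : Type*} [TopologicalSpace X] [T2Space X] [LocallyCompactSpace X]
    [MeasurableSpace X] [BorelSpace X] {ι : Type*} [Countable ι]
    (κ : X → X → EReal) (hκ : IsKernel κ)
    (hcons : Consistent κ) (hspd : StrictlyPositiveDefinite κ)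
    (A : Condenser X ι) (a : ι → ℝ) (ha : ∀ i, 0 < a i)
    (g : ι → X → ℝ) (hgc : ∀ i, Continuous (g i)) (hgpos : ∀ i x, 0 < g i x)
    (hstanding : A.plus = Set.univ ∨ (A.SummableCondition a g ∧ A.KernelBounded κ))
    (hgrowth : ∀ i, BddAbove (g i '' A.plate i) ∨ A.Growth κ g i)
    (hj : ∃ j, interiorCapacity κ (A.plate j) < ∞) :
    A.capacity κ a g < ∞ := by
  obtain ⟨k, c, h⟩ := hκ.exists_isShift hspd.1.1
  obtain ⟨j, hj⟩ := hj
  by_cases hX : CompactSpace X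
  · exact h.capacity_lt_top_of_compactSpace hspd hcons ha hgc (hstanding.imp_right And.right) j
  · obtain rfl := h.eq_zero hX
    exact h.capacity_lt_top_of_nonneg hspd hcons ha hgc hgpos hstanding (hgrowth j) hj
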